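/- A bipartite hypergraph $H=(A,B,E)$ consists of two disjoint finite vertex sets $A,B$ and a set $E$ of edges $e\subseteq A\cup B$ with $|e\cap A|=1$ and $|e\cap B|\ge 1$. It is $r$-bounded if $|e\cap B|\le r$ for all $e\in E$. For $S\subseteq A$ let $E_S=\{e\in E: e\cap S\ne\emptyset\}$ and let $\tau(E_S)$ be the minimum size of a set $T\subseteq B$ that meets every edge of $E_S$; $H$ satisfies the $\varphi$-strong Haxell condition if $\tau(E_S)\ge\varphi|S|$ for every $S\subseteq A$. A perfect matching of $H$ is a set of pairwise disjoint edges of $H$ that covers every vertex of $A$. The total volume of $H$ is $p=\sum_{e\in E}|e|$. **Theorem.** There are a (deterministic) algorithm on a unit-cost random access machine (with addition, truncated subtraction and comparison as its arithmetic) and a polynomial $q$ such that the following holds for every integer $r\ge 1$, every real $\varphi\ge 4r^2$ and every $r$-bounded bipartite hypergraph $H$ that satisfies the $\varphi$-strong Haxell condition: given an explicit list of the edges of $H$, the algorithm computes a perfect matching of $H$ in at most $q(p)$ steps, where $p$ is the total volume of $H$. -/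

import Mathlib

/-- A (finite) bipartite hypergraph `H = (A, B, E)`: two disjoint vertex sets, and a set of edges
(sets of vertices), each with exactly one vertex in `A` and at least one vertex in `B`. -/
structure BipartiteHypergraph (V : Type*) [DecidableEq V] where
  /-- The vertices on the `A` side. -/
  A : Finset V
  /-- The vertices on the `B` side. -/
  B : Finset V
  /-- The edges. -/
  E : Finset (Finset V)
  disjoint_A_B : Disjoint A B
  edge_subset : ∀ e ∈ E, e ⊆ A ∪ B
  card_inter_A : ∀ e ∈ E, (e ∩ A).card = 1
  one_le_card_inter_B : ∀ e ∈ E, 1 ≤ (e ∩ B).card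

namespace BipartiteHypergraph

variable {V : Type*} [DecidableEq V] (H : BipartiteHypergraph V)

/-- `H` is `r`-bounded: every edge has at most `r` vertices in `B`. -/
def IsBounded (r : ℕ) : Prop :=
  ∀ e ∈ H.E, (e ∩ H.B).card ≤ r

/-- `E_S`, the edges that meet `S`. -/
def edgesMeeting (S : Finset V) : Finset (Finset V) :=
  H.E.filter fun e => (e ∩ S).Nonempty

/-- `τ(F)`, the least size of a set `T ⊆ B` that meets every edge in `F`. For `F ⊆ E` the set of
sizes is nonempty, because `T = B` meets every edge. -/
noncomputable def tau (F : Finset (Finset V)) : ℕ :=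
  sInf {k : ℕ | ∃ T ⊆ H.B, T.card = k ∧ ∀ e ∈ F, (e ∩ T).Nonempty}

/-- The `φ`-strong Haxell condition: `τ(E_S) ≥ φ |S|` for every `S ⊆ A`. -/
def StrongHaxell (φ : ℝ) : Prop :=
  ∀ S ⊆ H.A, φ * (S.card : ℝ) ≤ (H.tau (H.edgesMeeting S) : ℝ)

/-- The total volume `p = ∑_{e ∈ E} |e|`. -/
def volume : ℕ :=
  ∑ e ∈ H.E, e.card

/-- `M` is a matching: a set of pairwise disjoint edges of `H`. -/
def IsMatching (M : Finset (Finset V)) : Prop :=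
  M ⊆ H.E ∧ ∀ e ∈ M, ∀ f ∈ M, e ≠ f → Disjoint e f

/-- `M` is a perfect matching: a matching that covers every vertex of `A`. -/
def IsPerfectMatching (M : Finset (Finset V)) : Prop :=
  H.IsMatching M ∧ ∀ a ∈ H.A, ∃ e ∈ M, a ∈ e

/-- The edge `{a} ∪ {b₁, …, b_k}` that is written as the pair `(a, [b₁, …, b_k])`. -/
def edgeOf (x : V × List V) : Finset V :=
  insert x.1 x.2.toFinset

/-- `L` lists the edges of `H` explicitly: every edge occurs exactly once, as its vertex in `A`
together with a list without repetitions of its vertices in `B`. The order of the edges and the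
order of the vertices within an edge are arbitrary. -/
def IsListing (L : List (V × List V)) : Prop :=
  (∀ x ∈ L, x.1 ∈ H.A ∧ x.2.Nodup ∧ ∀ b ∈ x.2, b ∈ H.B) ∧
  (L.map edgeOf).Nodup ∧
  ∀ e, e ∈ L.map edgeOf ↔ e ∈ H.E

end BipartiteHypergraph

/-!
The machine model: a random access machine at unit cost, with structured control flow. The memory
consists of registers and of arrays with natural-number cells, all addressed by natural numbers; a
program refers to finitely many registers and arrays by fixed numbers, while the index into an array
is computed. The arithmetic is addition, truncated subtraction and comparison only (no
multiplication, no shifts), so that `t` steps lengthen a number by at most `O(t)` bits, and the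
unit-cost running time is polynomially related to the time of a Turing machine.
-/
namespace RAM

/-- Contents of the memory: `reg x` is the value of register `x`, and `arr k i` is the value of
cell `i` of array `k`. -/
@[ext]
structure State where
  /-- The registers. -/
  reg : ℕ → ℕ
  /-- The arrays. -/
  arr : ℕ → ℕ → ℕ

/-- Write `v` into register `x`. -/
def State.setReg (s : State) (x v : ℕ) : State :=
  { s with reg := Function.update s.reg x v }

/-- Write `v` into cell `i` of array `k`. -/
def State.setArr (s : State) (k i v : ℕ) : State :=
  { s with arr := Function.update s.arr k (Function.update (s.arr k) i v) }

/-- Expressions. -/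
inductive Expr where
  /-- A constant of the program. -/
  | const (n : ℕ)
  /-- The value of register `x`. -/
  | reg (x : ℕ)
  /-- The cell of array `k` at the computed index `i`. -/
  | get (k : ℕ) (i : Expr)
  /-- Addition. -/
  | add (a b : Expr)
  /-- Truncated subtraction. -/
  | sub (a b : Expr)
  /-- `1` if `a < b`, else `0`. -/
  | lt (a b : Expr)
  /-- `1` if `a = b`, else `0`. -/
  | eq (a b : Expr)

/-- The value of an expression. -/
def Expr.eval (s : State) : Expr → ℕ
  | .const n => n
  | .reg x => s.reg x
  | .get k i => s.arr k (i.eval s)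
  | .add a b => a.eval s + b.eval s
  | .sub a b => a.eval s - b.eval s
  | .lt a b => if a.eval s < b.eval s then 1 else 0
  | .eq a b => if a.eval s = b.eval s then 1 else 0

/-- The number of steps it takes to evaluate an expression: one per operation. -/
def Expr.cost : Expr → ℕ
  | .const _ => 1
  | .reg _ => 1
  | .get _ i => i.cost + 1
  | .add a b => a.cost + b.cost + 1
  | .sub a b => a.cost + b.cost + 1
  | .lt a b => a.cost + b.cost + 1
  | .eq a b => a.cost + b.cost + 1

/-- Programs. -/
inductive Prog where
  /-- Do nothing. -/
  | skip
  /-- Assign the value of `a` to register `x`. -/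
  | assign (x : ℕ) (a : Expr)
  /-- Store the value of `a` in the cell of array `k` at the computed index `i`. -/
  | store (k : ℕ) (i a : Expr)
  /-- Run `P`, then `Q`. -/
  | seq (P Q : Prog)
  /-- Run `P` if `a` is nonzero, and `Q` otherwise. -/
  | branch (a : Expr) (P Q : Prog)
  /-- As long as `a` is nonzero, run `P`. -/
  | loop (a : Expr) (P : Prog)

/-- `Exec P s t s'`: started with memory `s`, program `P` halts after exactly `t` steps with
memory `s'`. Execution is deterministic; a run that does not halt is related to nothing. -/
inductive Exec : Prog → State → ℕ → State → Prop where
  | skip (s : State) : Exec .skip s 1 s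
  | assign (s : State) (x : ℕ) (a : Expr) :
      Exec (.assign x a) s (a.cost + 1) (s.setReg x (a.eval s))
  | store (s : State) (k : ℕ) (i a : Expr) :
      Exec (.store k i a) s (i.cost + a.cost + 1) (s.setArr k (i.eval s) (a.eval s))
  | seq {P Q : Prog} {s s₁ s₂ : State} {t₁ t₂ : ℕ} :
      Exec P s t₁ s₁ → Exec Q s₁ t₂ s₂ → Exec (.seq P Q) s (t₁ + t₂) s₂
  | branch_true {a : Expr} {P Q : Prog} {s s₁ : State} {t : ℕ} :
      a.eval s ≠ 0 → Exec P s t s₁ → Exec (.branch a P Q) s (a.cost + 1 + t) s₁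
  | branch_false {a : Expr} {P Q : Prog} {s s₁ : State} {t : ℕ} :
      a.eval s = 0 → Exec Q s t s₁ → Exec (.branch a P Q) s (a.cost + 1 + t) s₁
  | loop_true {a : Expr} {P : Prog} {s s₁ s₂ : State} {t₁ t₂ : ℕ} :
      a.eval s ≠ 0 → Exec P s t₁ s₁ → Exec (.loop a P) s₁ t₂ s₂ →
        Exec (.loop a P) s (a.cost + 1 + t₁ + t₂) s₂
  | loop_false {a : Expr} {P : Prog} {s : State} :
      a.eval s = 0 → Exec (.loop a P) s (a.cost + 1) s

/-- The memory that holds the listed edges as input. Register `0` is the number of edges; cell `i`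
of array `0` is the `A`-vertex of edge `i`; cell `i` of array `1` is the number of `B`-vertices of
edge `i`; array `2` holds the `B`-vertices of all edges one after the other. The rest is `0`. -/
def input (L : List (ℕ × List ℕ)) : State where
  reg := fun x => if x = 0 then L.length else 0
  arr := fun k i =>
    if k = 0 then (L.map Prod.fst).getD i 0
    else if k = 1 then (L.map fun x => x.2.length).getD i 0
    else if k = 2 then (L.flatMap Prod.snd).getD i 0
    else 0

/-- The set of edges that a memory holds as output: edge `i` of the input is selected if cell `i`
of array `3` is nonzero. -/
def output (L : List (ℕ × List ℕ)) (s : State) : Finset (Finset ℕ) :=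
  (Finset.univ.filter fun i : Fin L.length => s.arr 3 i ≠ 0).image
    fun i => BipartiteHypergraph.edgeOf (L.get i)

end RAM

/-! The vertices of `A` are covered one after the other by a local search that never uncovers a
covered vertex. An uncovered root forms level 1 of a tree. A new layer consists of addable edges at
tree vertices, chosen greedily: addable edges are pairwise disjoint on the `B`-side, there are at
most `16 * r` of them at a vertex, and when chosen they avoid the selected edges of the tree. The
vertices of the selected edges that block the new layer form the next level. A free addable edge,
one that meets no selected edge, can replace the selected edge at its vertex.

Growth (`Forest.growth`): suppose that every level is quiet, that is, has few free edges compared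
with its selected edges. All edges at tree vertices below the cap are met by addable edges or by
selected edges of the tree, so the Haxell condition forces the number of addable edges to be of
order `r` times the size of the tree. Few of them are free, and a selected edge blocks at most `r`
of the others because these are disjoint. Hence the number of selected edges in the tree more than
doubles from level to level, and the depth is logarithmic.

Collapse (`Swapped.shrink`, `Swapped.root_matched`): if a level is not quiet, its free edges are
swapped in and everything beyond the level is discarded. By the cap, at least 1/64 of the selected
edges leave the level. At level 1 the swap covers the root, and the search ends.

Termination (`ValidSizes.potential_lt`): with level sizes `y i`, the sum of `2 ^ (-i) * (y i) ^
(-45)` over `i ≥ 2` never exceeds 1, and each round that does not finish raises it by at least `1 /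
((m + 2) * m ^ 45)`, where `m` is the number of edges. So the number of rounds is polynomial.

The search sees the hypergraph only as a `ConflictSystem`, whose fields `hitting` and `packing`
carry all that is needed of the Haxell condition and of boundedness. For the running time it
suffices to bound the iterations of every loop by one number `N` that is polynomial in the volume;
`Runs N` combines this with partial correctness. -/

namespace RAM

/-! ### Running times and a program logic for the machine -/

/-- A bound for the number of steps of a run in which every loop is iterated at most `N` times. -/
def Prog.timeBound (N : ℕ) : Prog → ℕ
  | .skip => 1
  | .assign _ a => a.cost + 1
  | .store _ i a => i.cost + a.cost + 1
  | .seq P Q => P.timeBound N + Q.timeBound N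
  | .branch a P Q => a.cost + 1 + P.timeBound N + Q.timeBound N
  | .loop a P => (N + 1) * (a.cost + 1 + P.timeBound N)

/-- `Prog.timeBound` as a polynomial in the number of iterations. -/
noncomputable def Prog.timePoly : Prog → Polynomial ℕ
  | .skip => 1
  | .assign _ a => Polynomial.C (a.cost + 1)
  | .store _ i a => Polynomial.C (i.cost + a.cost + 1)
  | .seq P Q => P.timePoly + Q.timePoly
  | .branch a P Q => Polynomial.C (a.cost + 1) + P.timePoly + Q.timePoly
  | .loop a P => (Polynomial.X + 1) * (Polynomial.C (a.cost + 1) + P.timePoly)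

theorem Prog.eval_timePoly (N : ℕ) (P : Prog) : P.timePoly.eval N = P.timeBound N := by
  induction P <;> simp_all [Prog.timePoly, Prog.timeBound]

/-- Whether the program contains an assignment to register `x`. -/
def Prog.setsReg (x : ℕ) : Prog → Bool
  | .skip => false
  | .assign y _ => x == y
  | .store _ _ _ => false
  | .seq P Q => P.setsReg x || Q.setsReg x
  | .branch _ P Q => P.setsReg x || Q.setsReg x
  | .loop _ P => P.setsReg x

/-- Whether the program contains a store to array `k`. -/
def Prog.setsArr (k : ℕ) : Prog → Bool
  | .skip => false
  | .assign _ _ => false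
  | .store l _ _ => k == l
  | .seq P Q => P.setsArr k || Q.setsArr k
  | .branch _ P Q => P.setsArr k || Q.setsArr k
  | .loop _ P => P.setsArr k

/-- `s` and `s'` agree on the registers and arrays that `P` does not write to. -/
def Frame (P : Prog) (s s' : State) : Prop :=
  (∀ x, P.setsReg x = false → s'.reg x = s.reg x) ∧ ∀ k, P.setsArr k = false → s'.arr k = s.arr k

theorem Frame.refl (P : Prog) (s : State) : Frame P s s := ⟨fun _ _ => rfl, fun _ _ => rfl⟩

theorem Frame.trans {P : Prog} {s s₁ s₂ : State} (h₁ : Frame P s s₁) (h₂ : Frame P s₁ s₂) :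
    Frame P s s₂ :=
  ⟨fun x hx => (h₂.1 x hx).trans (h₁.1 x hx), fun k hk => (h₂.2 k hk).trans (h₁.2 k hk)⟩

theorem Frame.mono {P Q : Prog} {s s' : State} (h : Frame P s s')
    (hr : ∀ x, Q.setsReg x = false → P.setsReg x = false)
    (ha : ∀ k, Q.setsArr k = false → P.setsArr k = false) : Frame Q s s' :=
  ⟨fun x hx => h.1 x (hr x hx), fun k hk => h.2 k (ha k hk)⟩

@[simp] theorem State.setReg_reg (s : State) (x v y : ℕ) :
    (s.setReg x v).reg y = if y = x then v else s.reg y := by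
  simp [State.setReg, Function.update_apply]

@[simp] theorem State.setReg_arr (s : State) (x v : ℕ) : (s.setReg x v).arr = s.arr := rfl

@[simp] theorem State.setArr_reg (s : State) (k i v : ℕ) : (s.setArr k i v).reg = s.reg := rfl

theorem State.setArr_arr (s : State) (k i v l : ℕ) :
    (s.setArr k i v).arr l = if l = k then Function.update (s.arr k) i v else s.arr l := by
  simp [State.setArr, Function.update_apply]

@[simp] theorem State.setArr_arr_self (s : State) (k i v : ℕ) :
    (s.setArr k i v).arr k = Function.update (s.arr k) i v := by
  simp [State.setArr]

theorem State.setArr_arr_of_ne (s : State) {k l : ℕ} (i v : ℕ) (h : l ≠ k) :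
    (s.setArr k i v).arr l = s.arr l := by
  simp [State.setArr, h]

/-- Specifications can be kept to what a program changes: since `setsReg` and `setsArr` evaluate on
concrete programs, preservation of everything else is later proved by `rfl`. -/
theorem Exec.frame {P : Prog} {s s' : State} {t : ℕ} (h : Exec P s t s') : Frame P s s' := by
  induction h with
  | skip s => exact Frame.refl _ _
  | assign s x a =>
    refine ⟨fun y hy => ?_, fun _ _ => rfl⟩
    have : y ≠ x := by simpa [Prog.setsReg] using hy
    simp [this]
  | store s k i a =>
    refine ⟨fun _ _ => rfl, fun l hl => ?_⟩
    have : l ≠ k := by simpa [Prog.setsArr] using hl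
    exact State.setArr_arr_of_ne _ _ _ this
  | seq _ _ h₁ h₂ =>
    exact (h₁.mono (by simp +contextual [Prog.setsReg]) (by simp +contextual [Prog.setsArr])).trans
      (h₂.mono (by simp +contextual [Prog.setsReg]) (by simp +contextual [Prog.setsArr]))
  | branch_true _ _ h =>
    exact h.mono (by simp +contextual [Prog.setsReg]) (by simp +contextual [Prog.setsArr])
  | branch_false _ _ h =>
    exact h.mono (by simp +contextual [Prog.setsReg]) (by simp +contextual [Prog.setsArr])
  | loop_true _ _ _ h₁ h₂ => 
    exact (h₁.mono (by simp [Prog.setsReg]) (by simp [Prog.setsArr])).trans h₂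
  | loop_false _ => exact Frame.refl _ _

/-- Started in `s`, the program halts within `P.timeBound N` steps in a state that satisfies
`Q`. -/
def Runs (N : ℕ) (P : Prog) (s : State) (Q : State → Prop) : Prop :=
  ∃ t s', Exec P s t s' ∧ t ≤ P.timeBound N ∧ Q s'

namespace Runs

variable {N : ℕ} {P P' : Prog} {s : State} {Q Q' : State → Prop}

theorem mono (h : Runs N P s Q) (hQ : ∀ s', Frame P s s' → Q s' → Q' s') : Runs N P s Q' := by
  obtain ⟨t, s', h₁, h₂, h₃⟩ := h
  exact ⟨t, s', h₁, h₂, hQ s' h₁.frame h₃⟩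

theorem skip (h : Q s) : Runs N .skip s Q := ⟨_, _, .skip s, le_rfl, h⟩

theorem assign {x : ℕ} {a : Expr} (h : Q (s.setReg x (a.eval s))) : Runs N (.assign x a) s Q :=
  ⟨_, _, .assign s x a, le_rfl, h⟩

theorem store {k : ℕ} {i a : Expr} (h : Q (s.setArr k (i.eval s) (a.eval s))) :
    Runs N (.store k i a) s Q :=
  ⟨_, _, .store s k i a, le_rfl, h⟩

theorem seq (h : Runs N P s fun s' => Runs N P' s' Q) : Runs N (.seq P P') s Q := by
  obtain ⟨t, s', h₁, h₂, t', s'', h₃, h₄, h₅⟩ := h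
  exact ⟨_, _, .seq h₁ h₃, Nat.add_le_add h₂ h₄, h₅⟩

theorem branch {a : Expr} (h₁ : a.eval s ≠ 0 → Runs N P s Q) (h₂ : a.eval s = 0 → Runs N P' s Q) :
    Runs N (.branch a P P') s Q := by
  by_cases h : a.eval s = 0
  · obtain ⟨t, s', h₃, h₄, h₅⟩ := h₂ h
    exact ⟨_, _, .branch_false h h₃, by simp only [Prog.timeBound]; omega, h₅⟩
  · obtain ⟨t, s', h₃, h₄, h₅⟩ := h₁ h
    exact ⟨_, _, .branch_true h h₃, by simp only [Prog.timeBound]; omega, h₅⟩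

theorem loop {a : Expr} (I : State → Prop) (μ : State → ℕ) (h₀ : I s) (hN : μ s ≤ N)
    (hI : ∀ s', Frame P s s' → I s' → a.eval s' ≠ 0 →
      Runs N P s' fun s'' => I s'' ∧ μ s'' < μ s')
    (hQ : ∀ s', Frame P s s' → I s' → a.eval s' = 0 → Q s') : Runs N (.loop a P) s Q := by
  -- Induction on a bound for the variant. The body is always charged `P.timeBound N`, with the same
  -- `N` for the loops nested in it, and the extra unit in `n + 1` pays for the final failing test.
  have key : ∀ n s', Frame P s s' → I s' → μ s' ≤ n →
      ∃ t s'', Exec (.loop a P) s' t s'' ∧ t ≤ (n + 1) * (a.cost + 1 + P.timeBound N) ∧ Q s'' := by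
    intro n
    induction n with
    | zero =>
      intro s' hf hs' hμ
      by_cases h : a.eval s' = 0
      · exact ⟨_, _, .loop_false h, by omega, hQ s' hf hs' h⟩
      · obtain ⟨_, _, _, _, _, h⟩ := hI s' hf hs' h
        omega
    | succ n ih =>
      intro s' hf hs' hμ
      by_cases h : a.eval s' = 0
      · exact ⟨_, _, .loop_false h, by nlinarith, hQ s' hf hs' h⟩
      · obtain ⟨t₁, s₁, h₁, h₂, h₃, h₄⟩ := hI s' hf hs' h
        obtain ⟨t₂, s₂, h₅, h₆, h₇⟩ := ih s₁ (hf.trans h₁.frame) h₃ (by omega)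
        refine ⟨_, _, .loop_true h h₁ h₅, ?_, h₇⟩
        rw [Nat.succ_mul]
        omega
  obtain ⟨t, s', h₁, h₂, h₃⟩ := key (μ s) s (Frame.refl _ _) h₀ le_rfl
  exact ⟨t, s', h₁, h₂.trans (Nat.mul_le_mul_right _ (by omega)), h₃⟩

end Runs

/-- Run `P` with register `x` running from `0` to the value of register `h`, excluded. -/
def forLoop (x h : ℕ) (P : Prog) : Prog :=
  .seq (.assign x (.const 0))
    (.loop (.lt (.reg x) (.reg h)) (.seq P (.assign x (.add (.reg x) (.const 1)))))

theorem Runs.forLoop {N : ℕ} {P : Prog} {s : State} {Q : State → Prop} {x h : ℕ}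
    (I : ℕ → State → Prop) (hN : s.reg h ≤ N) (hx : P.setsReg x = false)
    (hh : P.setsReg h = false) (hne : h ≠ x) (h₀ : I 0 (s.setReg x 0))
    -- The invariant for `i + 1` is required after the write to the counter, since the increment
    -- follows the body.
    (hI : ∀ i s', i < s.reg h → Frame (RAM.forLoop x h P) s s' → s'.reg x = i → I i s' →
      Runs N P s' fun s'' => I (i + 1) (s''.setReg x (i + 1)))
    (hQ : ∀ s', Frame (RAM.forLoop x h P) s s' → s'.reg x = s.reg h → I (s.reg h) s' → Q s') :
    Runs N (RAM.forLoop x h P) s Q := by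
  have hfr : ∀ s', Frame (.seq P (.assign x (.add (.reg x) (.const 1)))) (s.setReg x 0) s' →
      Frame (RAM.forLoop x h P) s s' := by
    intro s' hf
    refine ⟨fun y hy => ?_, fun k hk => ?_⟩
    · simp only [RAM.forLoop, Prog.setsReg, Bool.or_eq_false_iff, beq_eq_false_iff_ne] at hy
      rw [hf.1 y (by simp [Prog.setsReg, hy]), State.setReg_reg, if_neg hy.1]
    · rw [hf.2 k (by simpa [RAM.forLoop, Prog.setsArr] using hk)]
      rfl
  refine Runs.seq (Runs.assign (Runs.loop
    (fun s' => s'.reg h = s.reg h ∧ s'.reg x ≤ s.reg h ∧ I (s'.reg x) s')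
    (fun s' => s.reg h - s'.reg x) ?_ ?_ ?_ ?_))
  · simpa [hne, Expr.eval] using h₀
  · simpa [Expr.eval] using hN
  · rintro s' hf ⟨h₁, h₂, h₃⟩ h₄
    have hlt : s'.reg x < s.reg h := by simpa [Expr.eval, h₁] using h₄
    refine Runs.seq ((hI _ s' hlt (hfr s' hf) rfl h₃).mono fun s'' hf' hI' => Runs.assign ?_)
    have hx' : s''.reg x = s'.reg x := hf'.1 x hx
    have hh' : s''.reg h = s.reg h := (hf'.1 h hh).trans h₁
    simp only [Expr.eval, hx', State.setReg_reg, if_neg hne, hh', if_true]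
    exact ⟨⟨trivial, hlt, hI'⟩, by omega⟩
  · rintro s' hf ⟨h₁, h₂, h₃⟩ h₄
    have : s'.reg x = s.reg h := by
      have : s.reg h ≤ s'.reg x := by simpa [Expr.eval, h₁] using h₄
      omega
    exact hQ s' (hfr s' hf) this (this ▸ h₃)

/-- Conjunction. -/
def Expr.and (a b : Expr) : Expr :=
  .lt (.const 1) (.add (.lt (.const 0) a) (.lt (.const 0) b))

/-- Negation. -/
def Expr.not (a : Expr) : Expr := .eq a (.const 0)

@[simp] theorem Expr.eval_const (s : State) (n : ℕ) : (Expr.const n).eval s = n := rfl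
@[simp] theorem Expr.eval_reg (s : State) (x : ℕ) : (Expr.reg x).eval s = s.reg x := rfl
@[simp] theorem Expr.eval_get (s : State) (k : ℕ) (i : Expr) :
    (Expr.get k i).eval s = s.arr k (i.eval s) := rfl
@[simp] theorem Expr.eval_add (s : State) (a b : Expr) :
    (Expr.add a b).eval s = a.eval s + b.eval s := rfl
@[simp] theorem Expr.eval_sub (s : State) (a b : Expr) :
    (Expr.sub a b).eval s = a.eval s - b.eval s := rfl
@[simp] theorem Expr.eval_lt_eq_zero (s : State) (a b : Expr) :
    (Expr.lt a b).eval s = 0 ↔ ¬ a.eval s < b.eval s := by simp [Expr.eval]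
@[simp] theorem Expr.eval_eq_eq_zero (s : State) (a b : Expr) :
    (Expr.eq a b).eval s = 0 ↔ a.eval s ≠ b.eval s := by simp [Expr.eval]
@[simp] theorem Expr.eval_and_eq_zero (s : State) (a b : Expr) :
    (Expr.and a b).eval s = 0 ↔ ¬ (a.eval s ≠ 0 ∧ b.eval s ≠ 0) := by
  by_cases ha : a.eval s = 0 <;> by_cases hb : b.eval s = 0 <;>
    simp [Expr.and, Expr.eval, ha, hb, Nat.pos_iff_ne_zero]
@[simp] theorem Expr.eval_not_eq_zero (s : State) (a : Expr) :
    (Expr.not a).eval s = 0 ↔ a.eval s ≠ 0 := by simp [Expr.not]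

/-- Set register `y` to `1` if the condition holds for some value of register `x` below the value
of register `0`, and to `0` otherwise. -/
def anyLoop (x y : ℕ) (a : Expr) : Prog :=
  .seq (.assign y (.const 0)) (forLoop x 0 (.branch a (.assign y (.const 1)) .skip))

theorem Runs.anyLoop {N : ℕ} {s : State} {Q : State → Prop} {x y : ℕ} {a : Expr} (p : ℕ → Prop)
    (hN : s.reg 0 ≤ N) (hx : x ≠ 0) (hy : y ≠ 0) (hxy : x ≠ y)
    (hp : ∀ i s', i < s.reg 0 → Frame (RAM.anyLoop x y a) s s' → s'.reg x = i →
      (a.eval s' ≠ 0 ↔ p i))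
    (hQ : ∀ s', Frame (RAM.anyLoop x y a) s s' → (s'.reg y ≠ 0 ↔ ∃ i < s.reg 0, p i) → Q s') :
    Runs N (RAM.anyLoop x y a) s Q := by
  have hfr : ∀ s', Frame (RAM.forLoop x 0 (.branch a (.assign y (.const 1)) .skip))
      (s.setReg y 0) s' → Frame (RAM.anyLoop x y a) s s' := by
    intro s' hf
    refine ⟨fun z hz => ?_, fun k _ => hf.2 k rfl⟩
    simp only [RAM.anyLoop, RAM.forLoop, Prog.setsReg, Bool.or_eq_false_iff,
      beq_eq_false_iff_ne] at hz
    rw [hf.1 z (by simp [RAM.forLoop, Prog.setsReg, hz]), State.setReg_reg, if_neg hz.1]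
  have h0 : (s.setReg y 0).reg 0 = s.reg 0 := by simp [hy.symm]
  refine Runs.seq (Runs.assign (Runs.forLoop
    (fun n s' => (s'.reg y ≠ 0 ↔ ∃ i < n, p i)) (by simpa [hy.symm] using hN)
    (by simp [Prog.setsReg, hxy]) (by simp [Prog.setsReg, hy.symm]) hx.symm ?_ ?_ ?_))
  · simp [hxy.symm]
  · intro i s' hi hf hxi hs'
    rw [Expr.eval_const, h0] at hi
    have hpi := hp i s' hi (hfr s' hf) hxi
    refine Runs.branch (fun ha => Runs.assign ?_) fun ha => Runs.skip ?_
    · simp only [State.setReg_reg, if_neg hxy.symm, if_true]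
      simp only [Expr.eval_const, ne_eq, one_ne_zero, not_false_eq_true, true_iff]
      exact ⟨i, by omega, hpi.1 ha⟩
    · simp only [State.setReg_reg, if_neg hxy.symm, hs']
      have hni : ¬ p i := fun h => hpi.2 h ha
      exact ⟨fun ⟨j, h₁, h₂⟩ => ⟨j, by omega, h₂⟩, fun ⟨j, h₁, h₂⟩ =>
        ⟨j, lt_of_le_of_ne (by omega) (by rintro rfl; exact hni h₂), h₂⟩⟩
  · intro s' hf _ hs'
    rw [Expr.eval_const, h0] at hs'
    exact hQ s' (hfr s' hf) hs'

/-- Set register `y` to the number of values of register `x` below the value of register `0` for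
which the condition holds. -/
def countLoop (x y : ℕ) (a : Expr) : Prog :=
  .seq (.assign y (.const 0))
    (forLoop x 0 (.branch a (.assign y (.add (.reg y) (.const 1))) .skip))

open Classical in
theorem Runs.countLoop {N : ℕ} {s : State} {Q : State → Prop} {x y : ℕ} {a : Expr} (p : ℕ → Prop)
    (hN : s.reg 0 ≤ N) (hx : x ≠ 0) (hy : y ≠ 0) (hxy : x ≠ y)
    (hp : ∀ i s', i < s.reg 0 → Frame (RAM.countLoop x y a) s s' → s'.reg x = i →
      (a.eval s' ≠ 0 ↔ p i))
    (hQ : ∀ s', Frame (RAM.countLoop x y a) s s' →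
      s'.reg y = ((Finset.range (s.reg 0)).filter p).card → Q s') :
    Runs N (RAM.countLoop x y a) s Q := by
  have hfr : ∀ s', Frame (RAM.forLoop x 0
      (.branch a (.assign y (.add (.reg y) (.const 1))) .skip))
      (s.setReg y 0) s' → Frame (RAM.countLoop x y a) s s' := by
    intro s' hf
    refine ⟨fun z hz => ?_, fun k _ => hf.2 k rfl⟩
    simp only [RAM.countLoop, RAM.forLoop, Prog.setsReg, Bool.or_eq_false_iff,
      beq_eq_false_iff_ne] at hz
    rw [hf.1 z (by simp [RAM.forLoop, Prog.setsReg, hz]), State.setReg_reg, if_neg hz.1]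
  have h0 : (s.setReg y 0).reg 0 = s.reg 0 := by simp [hy.symm]
  refine Runs.seq (Runs.assign (Runs.forLoop
    (fun n s' => s'.reg y = ((Finset.range n).filter p).card) (by simpa [hy.symm] using hN)
    (by simp [Prog.setsReg, hxy]) (by simp [Prog.setsReg, hy.symm]) hx.symm ?_ ?_ ?_))
  · simp [hxy.symm]
  · intro i s' hi hf hxi hs'
    rw [Expr.eval_const, h0] at hi
    have hpi := hp i s' hi (hfr s' hf) hxi
    refine Runs.branch (fun ha => Runs.assign ?_) fun ha => Runs.skip ?_
    · simp [hxy.symm, Finset.range_add_one, Finset.filter_insert, hpi.1 ha, hs']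
    · have hni : ¬ p i := fun h => hpi.2 h ha
      simp [hxy.symm, Finset.range_add_one, Finset.filter_insert, hni, hs']
  · intro s' hf _ hs'
    rw [Expr.eval_const, h0] at hs'
    exact hQ s' (hfr s' hf) hs'

end RAM

/-! ### Conflict systems, search trees and the growth of levels -/

section

open Finset

/-- The combinatorial data of a hypergraph with edges `0, …, m - 1`: the `A`-vertex of every edge
and the relation `Conf` of having a common `B`-vertex. -/
structure ConflictSystem where
  /-- The number of edges. -/
  m : ℕ
  /-- The bound for the number of `B`-vertices of an edge. -/
  r : ℕ
  /-- The `A`-vertex of an edge. -/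
  vert : ℕ → ℕ
  /-- Two edges have a common `B`-vertex. -/
  Conf : ℕ → ℕ → Prop
  symm : ∀ e f, Conf e f → Conf f e
  refl : ∀ e < m, Conf e e
  one_le_r : 0 < m → 1 ≤ r
  -- The Haxell condition in terms of edges: the `B`-vertices of the edges in `F` form a hitting set
  -- of size at most `r * F.card`, while at least `4 * r ^ 2 * S.card` vertices are needed.
  hitting : ∀ F S : Finset ℕ, F ⊆ range m → S ⊆ (range m).image vert →
    (∀ e < m, vert e ∈ S → ∃ f ∈ F, Conf e f) → 4 * r * S.card ≤ F.card
  -- Boundedness in terms of edges: disjoint edges that meet `f` use up distinct `B`-vertices of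
  -- `f`.
  packing : ∀ X : Finset ℕ, X ⊆ range m → ∀ f < m, (∀ e ∈ X, Conf e f) →
    (∀ e ∈ X, ∀ e' ∈ X, e ≠ e' → ¬ Conf e e') → X.card ≤ r

/-- The state of the local search: the selected edges, the layers of the addable edges (`0` for the
other edges) and the levels of the `A`-vertices in the search tree (`0` for the other vertices). -/
@[ext]
structure Config where
  /-- Nonzero for the edges in the current matching. -/
  sel : ℕ → ℕ
  /-- The layer of an addable edge, `0` for other edges. -/
  layer : ℕ → ℕ
  /-- The level of a vertex in the tree, `0` for other vertices. -/
  level : ℕ → ℕ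

namespace ConflictSystem

open Classical

variable (G : ConflictSystem)

/-- The vertex `v` is covered by a selected edge. -/
def Matched (c : Config) (v : ℕ) : Prop := ∃ f < G.m, c.sel f ≠ 0 ∧ G.vert f = v

/-- The edge `e` is disjoint on the `B`-side from all selected edges. -/
def Free (c : Config) (e : ℕ) : Prop := ∀ f < G.m, c.sel f ≠ 0 → ¬ G.Conf e f

/-- The selected edges at the vertices of level `i`. -/
noncomputable def lvl (c : Config) (i : ℕ) : Finset ℕ :=
  (range G.m).filter fun f => c.sel f ≠ 0 ∧ c.level (G.vert f) = i

/-- The free addable edges at the vertices of level `i`. -/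
noncomputable def freeAt (c : Config) (i : ℕ) : Finset ℕ :=
  (range G.m).filter fun e => c.layer e ≠ 0 ∧ c.level (G.vert e) = i ∧ G.Free c e

/-- There are few free addable edges at level `i`. -/
def Quiet (c : Config) (i : ℕ) : Prop := 4 * (G.freeAt c i).card ≤ G.r * (G.lvl c i).card

/-- The selected edges form a matching. -/
def IsMatching (c : Config) : Prop :=
  ∀ e < G.m, ∀ f < G.m, c.sel e ≠ 0 → c.sel f ≠ 0 → e ≠ f → G.vert e ≠ G.vert f ∧ ¬ G.Conf e f

/-- The first `k` levels of the search tree are well-formed. -/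
structure Forest (c : Config) (root k : ℕ) : Prop where
  matching : G.IsMatching c
  -- Disjointness and the cap concern all layers, also those beyond `k`: while level `k` is being
  -- collapsed the higher layers are still present, and the edges swapped in come from them.
  layer_disj : ∀ e < G.m, ∀ f < G.m, c.layer e ≠ 0 → c.layer f ≠ 0 → e ≠ f → ¬ G.Conf e f
  layer_level : ∀ e < G.m, c.layer e ≠ 0 → c.layer e ≤ k →
    1 ≤ c.level (G.vert e) ∧ c.level (G.vert e) < c.layer e
  cap : ∀ v, ((range G.m).filter fun e => c.layer e ≠ 0 ∧ G.vert e = v).card ≤ 16 * G.r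
  blocked : ∀ e < G.m, ∀ f < G.m, c.layer e ≠ 0 → c.layer e ≤ k → c.sel f ≠ 0 → G.Conf e f →
    c.level (G.vert f) = c.layer e
  root_mem : ∃ e < G.m, G.vert e = root
  level_ne : ∀ e < G.m, c.level (G.vert e) ≠ 0 →
    G.vert e = root ∨ 2 ≤ c.level (G.vert e) ∧ G.Matched c (G.vert e)
  -- Greedy choice of layer `i + 1`: an edge at a tree vertex is missing only because its vertex has
  -- reached the cap or because it meets an addable edge or a selected edge of the tree as it was
  -- then.
  maximal : ∀ i, 1 ≤ i → i < k → ∀ e < G.m, 1 ≤ c.level (G.vert e) → c.level (G.vert e) ≤ i →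
    16 * G.r ≤ ((range G.m).filter fun f =>
      c.layer f ≠ 0 ∧ c.layer f ≤ i + 1 ∧ G.vert f = G.vert e).card ∨
    ∃ f < G.m, G.Conf e f ∧ (c.layer f ≠ 0 ∧ c.layer f ≤ i + 1 ∨
      c.sel f ≠ 0 ∧ 1 ≤ c.level (G.vert f) ∧ c.level (G.vert f) ≤ i)

/-- The root has level `1` and is not covered. -/
def RootOpen (c : Config) (root : ℕ) : Prop := c.level root = 1 ∧ ¬ G.Matched c root

/-- There are no layers and levels beyond `k`. -/
def Trimmed (c : Config) (k : ℕ) : Prop :=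
  ∀ e < G.m, c.layer e ≤ k ∧ c.level (G.vert e) ≤ k

/-- The selected edges at the vertices of levels `1, …, i`. -/
noncomputable def lvls (c : Config) (i : ℕ) : Finset ℕ :=
  (range G.m).filter fun f => c.sel f ≠ 0 ∧ 1 ≤ c.level (G.vert f) ∧ c.level (G.vert f) ≤ i

variable {G}

theorem card_lvls_succ (c : Config) (i : ℕ) :
    (G.lvls c (i + 1)).card = (G.lvls c i).card + (G.lvl c (i + 1)).card := by
  rw [← card_union_of_disjoint]
  · congr 1
    ext f
    simp only [lvls, lvl, mem_union, mem_filter, mem_range]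
    constructor
    · rintro ⟨h₁, h₂, h₃, h₄⟩
      by_cases h : c.level (G.vert f) = i + 1
      · exact .inr ⟨h₁, h₂, h⟩
      · exact .inl ⟨h₁, h₂, h₃, by omega⟩
    · rintro (⟨h₁, h₂, h₃, h₄⟩ | ⟨h₁, h₂, h₃⟩) <;> exact ⟨h₁, h₂, by omega, by omega⟩
  · rw [disjoint_left]
    simp only [lvls, lvl, mem_filter]
    rintro f ⟨-, -, -, h⟩ ⟨-, -, h'⟩
    omega

theorem card_lvls (c : Config) (i : ℕ) :
    (G.lvls c i).card = ∑ j ∈ Icc 1 i, (G.lvl c j).card := by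
  induction i with
  | zero =>
    rw [Finset.card_eq_zero.2]
    · simp
    · rw [lvls, filter_eq_empty_iff]
      rintro f - ⟨-, h₁, h₂⟩
      omega
  | succ i ih => rw [card_lvls_succ, ih, Finset.sum_Icc_succ_top (by omega)]

theorem card_lvl_le (c : Config) (i : ℕ) : (G.lvl c i).card ≤ G.m :=
  (card_filter_le _ _).trans (by simp)

theorem card_lvls_le (c : Config) (i : ℕ) : (G.lvls c i).card ≤ G.m :=
  (card_filter_le _ _).trans (by simp)

/-- The tree grows: level `i + 1` is larger than all the levels before it. -/
theorem Forest.growth {c : Config} {root k i : ℕ} (h : G.Forest c root k)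
    (hr : G.RootOpen c root) (hq : ∀ j, 1 ≤ j → j < k → G.Quiet c j) (hi : 1 ≤ i) (hik : i < k) :
    2 * (G.lvls c i).card + 2 ≤ (G.lvls c (i + 1)).card := by
  obtain ⟨e₀, he₀, hroot⟩ := h.root_mem
  have hr1 := G.one_le_r (by omega)
  set S := ((range G.m).image G.vert).filter fun v => 1 ≤ c.level v ∧ c.level v ≤ i with hS
  set X := (range G.m).filter fun e => c.layer e ≠ 0 ∧ c.layer e ≤ i + 1 with hX
  set d : ℕ → ℕ := fun v => (X.filter fun f => G.vert f = v).card with hd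
  have hd' : ∀ v, ((range G.m).filter fun f => c.layer f ≠ 0 ∧ c.layer f ≤ i + 1 ∧
      G.vert f = v).card = d v := by
    intro v
    simp only [hd, hX, filter_filter, and_assoc]
  have hXm : X ⊆ range G.m := filter_subset _ _
  -- At the vertices below the cap, maximality says that `X` and the selected edges of the tree meet
  -- every edge, so `hitting` applies.
  have h₁ : 4 * G.r * (S.filter fun v => ¬ 16 * G.r ≤ d v).card ≤ (X ∪ G.lvls c i).card := by
    refine G.hitting _ _ (union_subset hXm (filter_subset _ _))
      ((filter_subset _ _).trans (filter_subset _ _)) fun e he hv => ?_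
    simp only [hS, mem_filter, mem_image] at hv
    rcases h.maximal i hi hik e he hv.1.2.1 hv.1.2.2 with h' | ⟨f, hf, h', h''⟩
    · rw [hd'] at h'
      exact absurd h' hv.2
    · refine ⟨f, ?_, h'⟩
      rw [mem_union]
      rcases h'' with h'' | h''
      · exact .inl (mem_filter.2 ⟨mem_range.2 hf, h''⟩)
      · exact .inr (mem_filter.2 ⟨mem_range.2 hf, h''⟩)
  have h₂ : 16 * G.r * (S.filter fun v => 16 * G.r ≤ d v).card ≤ X.card := by
    rw [mul_comm, ← smul_eq_mul]
    refine (card_nsmul_le_sum _ d _ fun v hv => (mem_filter.1 hv).2).trans ?_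
    rw [← card_biUnion]
    · exact card_le_card (biUnion_subset.2 fun v _ => filter_subset _ _)
    · intro v _ w _ hvw
      rw [Function.onFun, disjoint_left]
      intro f hf hf'
      exact hvw ((mem_filter.1 hf).2.symm.trans (mem_filter.1 hf').2)
  have h₃ : (S.filter fun v => 16 * G.r ≤ d v).card +
      (S.filter fun v => ¬ 16 * G.r ≤ d v).card = S.card :=
    card_filter_add_card_filter_not _
  -- Besides the vertices of the selected edges, the tree contains the uncovered root.
  have h₄ : (G.lvls c i).card + 1 ≤ S.card := by
    have hinj : Set.InjOn G.vert (G.lvls c i) := by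
      intro e he f hf hef
      have he := mem_filter.1 (mem_coe.1 he)
      have hf := mem_filter.1 (mem_coe.1 hf)
      by_contra hne
      exact (h.matching e (mem_range.1 he.1) f (mem_range.1 hf.1) he.2.1 hf.2.1 hne).1 hef
    have hnot : root ∉ (G.lvls c i).image G.vert := by
      rw [mem_image]
      rintro ⟨f, hf, hfr⟩
      have hf := mem_filter.1 hf
      exact hr.2 ⟨f, mem_range.1 hf.1, hf.2.1, hfr⟩
    rw [← card_image_of_injOn hinj, ← card_insert_of_notMem hnot]
    refine card_le_card (insert_subset ?_ ?_)
    · exact mem_filter.2 ⟨mem_image.2 ⟨e₀, mem_range.2 he₀, hroot⟩, by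
        rw [hr.1]; exact ⟨le_rfl, hi⟩⟩
    · intro v hv
      obtain ⟨f, hf, rfl⟩ := mem_image.1 hv
      have hf := mem_filter.1 hf
      exact mem_filter.2 ⟨mem_image_of_mem _ hf.1, hf.2.2⟩
  -- An edge in a layer up to `i + 1` sits at a level up to `i`, so the free edges in `X` are
  -- counted by quiet levels only.
  have h₅ : 4 * (X.filter fun e => G.Free c e).card ≤ G.r * (G.lvls c i).card := by
    have : X.filter (fun e => G.Free c e) ⊆ (Icc 1 i).biUnion fun j => G.freeAt c j := by
      intro e he
      simp only [hX, mem_filter, mem_range] at he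
      have := h.layer_level e he.1.1 he.1.2.1 (by omega)
      exact mem_biUnion.2 ⟨c.level (G.vert e), mem_Icc.2 ⟨this.1, by omega⟩,
        mem_filter.2 ⟨mem_range.2 he.1.1, he.1.2.1, rfl, he.2⟩⟩
    calc 4 * (X.filter fun e => G.Free c e).card
        ≤ 4 * ∑ j ∈ Icc 1 i, (G.freeAt c j).card :=
          Nat.mul_le_mul_left _ ((card_le_card this).trans card_biUnion_le)
      _ = ∑ j ∈ Icc 1 i, 4 * (G.freeAt c j).card := mul_sum _ _ _
      _ ≤ ∑ j ∈ Icc 1 i, G.r * (G.lvl c j).card := sum_le_sum fun j hj => by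
          rw [mem_Icc] at hj
          exact hq j hj.1 (by omega)
      _ = G.r * (G.lvls c i).card := by rw [card_lvls, mul_sum]
  -- A blocked edge is blocked by a selected edge whose level equals the layer of the blocked edge,
  -- and by `packing` each selected edge blocks at most `r` of the disjoint edges in `X`.
  have h₆ : (X.filter fun e => ¬ G.Free c e).card ≤ (G.lvls c (i + 1)).card * G.r := by
    have : X.filter (fun e => ¬ G.Free c e) ⊆
        (G.lvls c (i + 1)).biUnion fun f => X.filter fun e => G.Conf e f := by
      intro e he
      have heX := (mem_filter.1 he).1
      simp only [hX, mem_filter, mem_range, Free] at he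
      push Not at he
      obtain ⟨⟨hem, hl, hli⟩, f, hf, hs, hc⟩ := he
      have := h.blocked e hem f hf hl (by omega) hs hc
      exact mem_biUnion.2 ⟨f, mem_filter.2 ⟨mem_range.2 hf, hs, by omega, by omega⟩,
        mem_filter.2 ⟨heX, hc⟩⟩
    refine (card_le_card this).trans (card_biUnion_le_card_mul _ _ _ fun f hf => ?_)
    refine G.packing _ ((filter_subset _ _).trans hXm) f
      (mem_range.1 (mem_filter.1 hf).1) (fun e he => (mem_filter.1 he).2) ?_
    intro e he e' he' hne
    have he := mem_filter.1 (mem_filter.1 he).1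
    have he' := mem_filter.1 (mem_filter.1 he').1
    exact h.layer_disj e (mem_range.1 he.1) e' (mem_range.1 he'.1) he.2.1 he'.2.1 hne
  have h₇ : (X.filter fun e => G.Free c e).card + (X.filter fun e => ¬ G.Free c e).card = X.card :=
    card_filter_add_card_filter_not _
  have h₈ := card_union_le X (G.lvls c i)
  generalize (S.filter fun v => 16 * G.r ≤ d v).card = s₁ at *
  generalize (S.filter fun v => ¬ 16 * G.r ≤ d v).card = s₂ at *
  generalize (X.filter fun e => G.Free c e).card = x₁ at *
  generalize (X.filter fun e => ¬ G.Free c e).card = x₂ at *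
  generalize (G.lvls c i).card = y at *
  generalize (G.lvls c (i + 1)).card = z at *
  generalize S.card = t at *
  generalize (X ∪ G.lvls c i).card = u at *
  have h₉ : y + 1 ≤ G.r * t := h₄.trans (Nat.le_mul_of_pos_left _ hr1)
  have h₁₀ : G.r * (y + 1) ≤ G.r * t := Nat.mul_le_mul_left _ h₄
  -- Four times `h₁` plus `h₂` gives `16rt ≤ 5x + 4y` with `x = x₁ + x₂ ≤ ry/4 + rz`. Multiplied by
  -- 4 this is `64rt ≤ 5ry + 20rz + 16y`. With `y + 1 ≤ t` and `1 ≤ r`, what remains on the left is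
  -- at least `64 - 5 - 16 = 43` times `r(y + 1)`.
  have h₁₁ : G.r * (43 * (y + 1)) ≤ G.r * (20 * z) := by
    rw [← h₃] at h₉ h₁₀
    nlinarith
  have := Nat.le_of_mul_le_mul_left h₁₁ hr1
  omega

/-- Consequences of the growth for the sizes of the levels. -/
theorem Forest.sizes {c : Config} {root k : ℕ} (h : G.Forest c root k)
    (hr : G.RootOpen c root) (hq : ∀ j, 1 ≤ j → j < k → G.Quiet c j) (hk : 1 ≤ k) :
    2 ^ k ≤ G.m + 2 ∧
      ∀ i, 1 ≤ i → i < k → (G.lvl c i).card < (G.lvl c (i + 1)).card := by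
  constructor
  · have : ∀ i, 1 ≤ i → i ≤ k → 2 ^ i ≤ (G.lvls c i).card + 2 := by
      intro i hi
      induction i, hi using Nat.le_induction with
      | base => intro _; omega
      | succ i hi ih =>
        intro hik
        have h₁ := ih (by omega)
        have h₂ := h.growth hr hq hi (by omega)
        rw [pow_succ]
        omega
    exact (this k hk le_rfl).trans (Nat.add_le_add_right (card_lvls_le c k) 2)
  · intro i hi hik
    have h₁ := h.growth hr hq hi hik
    have h₂ := card_lvls_succ (G := G) c i
    have h₃ : (G.lvl c i).card ≤ (G.lvls c i).card := by
      rw [card_lvls]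
      exact single_le_sum (f := fun j => (G.lvl c j).card) (fun _ _ => Nat.zero_le _)
        (mem_Icc.2 ⟨hi, le_rfl⟩)
    omega

/-- The level of the vertex of an addable edge is below the layer of the edge, hence below `k`; the
last level and everything beyond it carry no addable edges. -/
theorem Forest.quiet_of_le {c : Config} {root k i : ℕ} (h : G.Forest c root k)
    (ht : G.Trimmed c k) (hi : k ≤ i) : G.Quiet c i := by
  have : G.freeAt c i = ∅ := by
    rw [freeAt, filter_eq_empty_iff]
    rintro e he ⟨h₁, h₂, -⟩
    have he := mem_range.1 he
    have := h.layer_level e he h₁ (ht e he).1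
    have := (ht e he).1
    omega
  simp [Quiet, this]

end ConflictSystem

namespace ConflictSystem

open Classical

variable {G : ConflictSystem}

/-! ### Swaps -/

variable (G) in
/-- Cover the vertex of `e` by `e` instead of its former edge, and remove it from the tree. -/
noncomputable def swap (c : Config) (e : ℕ) : Config where
  sel f := if f = e then 1 else if f < G.m ∧ G.vert f = G.vert e then 0 else c.sel f
  layer := c.layer
  level := Function.update c.level (G.vert e) 0

theorem swap_sel_ne_zero {c : Config} {e f : ℕ} (hf : f < G.m) :
    (G.swap c e).sel f ≠ 0 ↔ f = e ∨ G.vert f ≠ G.vert e ∧ c.sel f ≠ 0 := by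
  by_cases h₁ : f = e <;> by_cases h₂ : G.vert f = G.vert e <;> simp [swap, h₁, h₂, hf]

theorem swap_level_of_ne {c : Config} {e v : ℕ} (h : v ≠ G.vert e) :
    (G.swap c e).level v = c.level v := by simp [swap, h]

theorem swap_level_self {c : Config} {e : ℕ} : (G.swap c e).level (G.vert e) = 0 := by
  simp [swap]

theorem Matched.swap {c : Config} {e v : ℕ} (he : e < G.m) (h : G.Matched c v) :
    G.Matched (G.swap c e) v := by
  obtain ⟨f, hf, hs, rfl⟩ := h
  by_cases hv : G.vert f = G.vert e
  · exact ⟨e, he, (swap_sel_ne_zero he).2 (.inl rfl), hv.symm⟩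
  · exact ⟨f, hf, (swap_sel_ne_zero hf).2 (.inr ⟨hv, hs⟩), rfl⟩

theorem matched_swap_self {c : Config} {e : ℕ} (he : e < G.m) :
    G.Matched (G.swap c e) (G.vert e) :=
  ⟨e, he, (swap_sel_ne_zero he).2 (.inl rfl), rfl⟩

theorem lvl_swap {c : Config} {e i : ℕ} (hi : i ≠ 0) :
    G.lvl (G.swap c e) i ⊆ G.lvl c i := by
  intro f hf
  obtain ⟨hf, hs, hl⟩ := mem_filter.1 hf
  have hv : G.vert f ≠ G.vert e := fun h => hi (by rw [← hl, h, swap_level_self])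
  rcases (swap_sel_ne_zero (mem_range.1 hf)).1 hs with rfl | hs
  · exact absurd rfl hv
  · exact mem_filter.2 ⟨hf, hs.2, by rwa [swap_level_of_ne hv] at hl⟩

theorem lvl_swap_eq {c : Config} {e i : ℕ} (hi : i ≠ 0) (hne : c.level (G.vert e) ≠ i) :
    G.lvl (G.swap c e) i = G.lvl c i := by
  refine (lvl_swap hi).antisymm fun f hf => ?_
  obtain ⟨hf, hs, hl⟩ := mem_filter.1 hf
  have hv : G.vert f ≠ G.vert e := fun h => hne (by rw [← hl, h])
  exact mem_filter.2 ⟨hf, (swap_sel_ne_zero (mem_range.1 hf)).2 (.inr ⟨hv, hs⟩), by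
    rwa [swap_level_of_ne hv]⟩

/-- The edge `e` lies in a layer beyond `j`, because its vertex has level `j`. So the layers up to
`j` are untouched, and they are not blocked by `e`, since addable edges are disjoint. Maximality
below `j` involves only vertices of smaller levels, which the swap leaves alone. -/
theorem Forest.swap {c : Config} {root j e : ℕ} (h : G.Forest c root j)
    (he : e < G.m) (hl : c.layer e ≠ 0) (hv : c.level (G.vert e) = j) (hf : G.Free c e) :
    G.Forest (G.swap c e) root j := by
  have hlj : j < c.layer e := by
    by_contra hle
    have := h.layer_level e he hl (by omega)
    omega
  refine ⟨?_, h.layer_disj, ?_, h.cap, ?_, h.root_mem, ?_, ?_⟩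
  · intro f hf' g hg hfs hgs hne
    rw [swap_sel_ne_zero hf'] at hfs
    rw [swap_sel_ne_zero hg] at hgs
    rcases hfs with rfl | hfs <;> rcases hgs with rfl | hgs
    · exact absurd rfl hne
    · exact ⟨hgs.1.symm, hf g hg hgs.2⟩
    · exact ⟨hfs.1, fun hc => hf f hf' hfs.2 (G.symm _ _ hc)⟩
    · exact h.matching f hf' g hg hfs.2 hgs.2 hne
  · intro f hf' hfl hflj
    change c.layer f ≤ j at hflj
    have := h.layer_level f hf' hfl hflj
    rw [swap_level_of_ne (fun h => by rw [h] at this; omega)]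
    exact this
  · intro f hf' g hg hfl hflj hgs hc
    change c.layer f ≤ j at hflj
    change c.layer f ≠ 0 at hfl
    rw [swap_sel_ne_zero hg] at hgs
    rcases hgs with rfl | hgs
    · exact absurd hc (h.layer_disj f hf' g hg hfl hl (by rintro rfl; omega))
    · rw [swap_level_of_ne hgs.1]
      exact h.blocked f hf' g hg hfl hflj hgs.2 hc
  · intro f hf' hfl
    have hne : G.vert f ≠ G.vert e := fun h => hfl (by rw [h, swap_level_self])
    rw [swap_level_of_ne hne] at hfl ⊢
    exact (h.level_ne f hf' hfl).imp_right fun h => ⟨h.1, h.2.swap he⟩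
  · intro i hi hij f hf' hfl hfli
    have hne : G.vert f ≠ G.vert e := fun h => by rw [h, swap_level_self] at hfl; omega
    rw [swap_level_of_ne hne] at hfl hfli
    refine (h.maximal i hi hij f hf' hfl hfli).imp_right ?_
    rintro ⟨g, hg, hc, hg'⟩
    refine ⟨g, hg, hc, hg'.imp_right fun hg' => ?_⟩
    have hne : G.vert g ≠ G.vert e := fun h => by rw [h] at hg'; omega
    rw [swap_level_of_ne hne, swap_sel_ne_zero hg]
    exact ⟨.inr ⟨hne, hg'.1⟩, hg'.2⟩

variable (G) in
/-- The configuration `c` arises from `c₀` by swaps at level `j`, and the edges below `n` have been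
processed. -/
structure Swapped (c₀ c : Config) (root j n : ℕ) : Prop where
  layer_eq : c.layer = c₀.layer
  forest : G.Forest c root j
  level : ∀ v, c.level v = c₀.level v ∨ c₀.level v = j ∧ c.level v = 0 ∧ G.Matched c v
  -- Only addable edges become selected. As they are disjoint from all other addable edges, swaps at
  -- this level do not destroy the freeness of edges still waiting to be processed.
  sel : ∀ f < G.m, c.sel f ≠ 0 → c₀.sel f ≠ 0 ∨
    c.layer f ≠ 0 ∧ c.level (G.vert f) = 0 ∧ c₀.level (G.vert f) = j
  matched : ∀ v, G.Matched c₀ v → G.Matched c v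
  lvl_eq : ∀ i, 1 ≤ i → i < j → G.lvl c i = G.lvl c₀ i
  lvl_subset : G.lvl c j ⊆ G.lvl c₀ j
  -- Freeness refers to the initial configuration, the one in which the free edges were counted.
  done : ∀ e < n, e ∈ G.freeAt c₀ j → c.level (G.vert e) ≠ j

theorem Swapped.init {c : Config} {root j : ℕ} (h : G.Forest c root j) :
    G.Swapped c c root j 0 :=
  ⟨rfl, h, fun _ => .inl rfl, fun _ _ h => .inl h, fun _ h => h, fun _ _ _ => rfl,
    Subset.rfl, fun e he => absurd he (Nat.not_lt_zero e)⟩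

theorem Swapped.step {c₀ c : Config} {root j n : ℕ} (h : G.Swapped c₀ c root j n) (hj : 1 ≤ j)
    (hn : n < G.m) (h₁ : c.layer n ≠ 0) (h₂ : c.level (G.vert n) = j) (h₃ : G.Free c n) :
    G.Swapped c₀ (G.swap c n) root j (n + 1) := by
  have hj₀ : c₀.level (G.vert n) = j := by
    rcases h.level (G.vert n) with h' | h' <;> omega
  refine ⟨h.layer_eq, h.forest.swap hn h₁ h₂ h₃, ?_, ?_, fun v hv => (h.matched v hv).swap hn,
    fun i hi hij => ?_, (lvl_swap (by omega)).trans h.lvl_subset, ?_⟩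
  · intro v
    by_cases hv : v = G.vert n
    · subst hv
      exact .inr ⟨hj₀, swap_level_self, matched_swap_self hn⟩
    · rw [swap_level_of_ne hv]
      exact (h.level v).imp_right fun h' => ⟨h'.1, h'.2.1, h'.2.2.swap hn⟩
  · intro f hf hs
    rcases (swap_sel_ne_zero hf).1 hs with rfl | ⟨hne, hs⟩
    · exact .inr ⟨h₁, swap_level_self, hj₀⟩
    · rw [swap_level_of_ne hne]
      exact h.sel f hf hs
  · rw [lvl_swap_eq (by omega) (by omega), h.lvl_eq i hi hij]
  · intro e he hfe
    by_cases hv : G.vert e = G.vert n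
    · rw [hv, swap_level_self]
      omega
    · rw [swap_level_of_ne hv]
      exact h.done e (lt_of_le_of_ne (by omega) (by rintro rfl; exact hv rfl)) hfe

/-- An edge that was free initially can only be blocked by a newly selected edge. A different
addable edge is disjoint from it; if it is that edge itself, its vertex has already left the tree.
-/
theorem Swapped.skip {c₀ c : Config} {root j n : ℕ} (h : G.Swapped c₀ c root j n) (hj : 1 ≤ j)
    (hn : n < G.m) (h' : ¬ (c.layer n ≠ 0 ∧ c.level (G.vert n) = j ∧ G.Free c n)) :
    G.Swapped c₀ c root j (n + 1) := by
  refine ⟨h.layer_eq, h.forest, h.level, h.sel, h.matched, h.lvl_eq, h.lvl_subset, ?_⟩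
  intro e he hfe
  rcases Nat.lt_succ_iff_lt_or_eq.1 he with he | rfl
  · exact h.done e he hfe
  · intro hl
    obtain ⟨-, hl₀, -, hfr⟩ := mem_filter.1 hfe
    rw [← h.layer_eq] at hl₀
    refine h' ⟨hl₀, hl, fun f hf hs hc => ?_⟩
    rcases h.sel f hf hs with hs | ⟨hlf, hvf, -⟩
    · exact hfr f hf hs hc
    · by_cases hef : e = f
      · subst hef
        omega
      · exact h.forest.layer_disj e hn f hf hl₀ hlf hef hc

theorem Swapped.rootOpen {c₀ c : Config} {root j n : ℕ} (h : G.Swapped c₀ c root j n)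
    (hj : 2 ≤ j) (hr : G.RootOpen c₀ root) : G.RootOpen c root := by
  refine ⟨?_, ?_⟩
  · rcases h.level root with h' | h'
    · exact h'.trans hr.1
    · have := hr.1
      omega
  · rintro ⟨f, hf, hs, rfl⟩
    rcases h.sel f hf hs with hs | ⟨-, -, hs⟩
    · exact hr.2 ⟨f, hf, hs, rfl⟩
    · have := hr.1
      omega

/-- If there are many free addable edges at level `j`, then the swaps remove a constant fraction
of the level. -/
theorem Swapped.shrink {c₀ c : Config} {root j k : ℕ} (h : G.Swapped c₀ c root j G.m)
    (h₀ : G.Forest c₀ root k) (hj : 2 ≤ j) (hr : G.RootOpen c₀ root) (hq : ¬ G.Quiet c₀ j) :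
    64 * (G.lvl c j).card ≤ 63 * (G.lvl c₀ j).card := by
  set V := (G.freeAt c₀ j).image G.vert with hV
  -- Since a vertex carries at most `16 * r` addable edges, more than `r * y / 4` free edges at a
  -- level with `y` selected edges involve more than `y / 64` vertices. Each of these vertices takes
  -- its old selected edge out of the level.
  have h₁ : (G.freeAt c₀ j).card ≤ V.card * (16 * G.r) := by
    have : G.freeAt c₀ j ⊆ V.biUnion fun v =>
        (range G.m).filter fun e => c₀.layer e ≠ 0 ∧ G.vert e = v := by
      intro e he
      have he' := mem_filter.1 he
      exact mem_biUnion.2 ⟨G.vert e, mem_image_of_mem _ he,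
        mem_filter.2 ⟨he'.1, he'.2.1, rfl⟩⟩
    exact (card_le_card this).trans (card_biUnion_le_card_mul _ _ _ fun v _ => h₀.cap v)
  have h₂ : V.card ≤ ((G.lvl c₀ j) \ (G.lvl c j)).card := by
    have : V ⊆ ((G.lvl c₀ j) \ (G.lvl c j)).image G.vert := by
      intro v hv
      obtain ⟨e, he, rfl⟩ := mem_image.1 hv
      obtain ⟨hem, -, hlev, -⟩ := mem_filter.1 he
      have hne := h.done e (mem_range.1 hem) he
      rcases h₀.level_ne e (mem_range.1 hem) (by omega) with hroot | ⟨-, f, hf, hs, hfe⟩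
      · rw [hroot, hr.1] at hlev
        omega
      · refine mem_image.2 ⟨f, mem_sdiff.2 ⟨mem_filter.2 ⟨mem_range.2 hf, hs, by rw [hfe, hlev]⟩,
          fun hf' => hne ?_⟩, hfe⟩
        rw [← hfe]
        exact (mem_filter.1 hf').2.2
    exact (card_le_card this).trans card_image_le
  have h₃ := card_sdiff_add_card_eq_card h.lvl_subset
  have h₄ : G.r * (G.lvl c₀ j).card < 4 * (G.freeAt c₀ j).card := not_le.1 hq
  generalize ((G.lvl c₀ j) \ (G.lvl c j)).card = x at *
  have h₅ : G.r * (G.lvl c₀ j).card < G.r * (64 * x) := by nlinarith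
  have := lt_of_mul_lt_mul_left h₅ (Nat.zero_le _)
  omega

/-- Failure of quietness yields a free edge at level 1, where the root is the only vertex of an
edge. Processing this edge removes the root from the tree, and vertices leave the tree only by being
covered. -/
theorem Swapped.root_matched {c₀ c : Config} {root k : ℕ} (h : G.Swapped c₀ c root 1 G.m)
    (h₀ : G.Forest c₀ root k) (hq : ¬ G.Quiet c₀ 1) :
    c.level root = 0 ∧ G.Matched c root := by
  have h₁ : G.r * (G.lvl c₀ 1).card < 4 * (G.freeAt c₀ 1).card := not_le.1 hq
  obtain ⟨e, he⟩ := card_pos.1 (show 0 < (G.freeAt c₀ 1).card by omega)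
  obtain ⟨hem, -, hlev, -⟩ := mem_filter.1 he
  have hne := h.done e (mem_range.1 hem) he
  rcases h₀.level_ne e (mem_range.1 hem) (by omega) with hroot | h'
  · rw [hroot] at hne hlev
    rcases h.level root with h' | h'
    · omega
    · exact h'.2
  · omega

/-! ### Truncation -/

variable (G) in
/-- The configuration `c'` arises from `c` by removing all layers and levels beyond `j`. -/
structure Truncated (c c' : Config) (j : ℕ) : Prop where
  sel : c'.sel = c.sel
  layer : ∀ e < G.m, c'.layer e = if j < c.layer e then 0 else c.layer e
  level : ∀ e < G.m, c'.level (G.vert e) =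
    if j < c.level (G.vert e) then 0 else c.level (G.vert e)

namespace Truncated

variable {c c' : Config} {root j : ℕ}

theorem layer_eq (h : G.Truncated c c' j) {e : ℕ} (he : e < G.m) (hl : c'.layer e ≠ 0) :
    c'.layer e = c.layer e ∧ c.layer e ≤ j := by
  rw [h.layer e he] at hl ⊢
  split_ifs at hl ⊢
  · exact absurd rfl hl
  · exact ⟨rfl, by omega⟩

theorem level_eq (h : G.Truncated c c' j) {e : ℕ} (he : e < G.m)
    (hl : c'.level (G.vert e) ≠ 0) :
    c'.level (G.vert e) = c.level (G.vert e) ∧ c.level (G.vert e) ≤ j := by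
  rw [h.level e he] at hl ⊢
  split_ifs at hl ⊢
  · exact absurd rfl hl
  · exact ⟨rfl, by omega⟩

theorem layer_eq_of_le (h : G.Truncated c c' j) {e : ℕ} (he : e < G.m) (hl : c.layer e ≤ j) :
    c'.layer e = c.layer e := by
  rw [h.layer e he, if_neg (by omega)]

theorem level_eq_of_le (h : G.Truncated c c' j) {e : ℕ} (he : e < G.m)
    (hl : c.level (G.vert e) ≤ j) : c'.level (G.vert e) = c.level (G.vert e) := by
  rw [h.level e he, if_neg (by omega)]

theorem matched_iff (h : G.Truncated c c' j) (v : ℕ) : G.Matched c' v ↔ G.Matched c v := by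
  simp only [Matched, h.sel]

theorem trimmed (h : G.Truncated c c' j) : G.Trimmed c' j := by
  intro e he
  rw [h.layer e he, h.level e he]
  constructor <;> split_ifs <;> omega

theorem lvl_eq (h : G.Truncated c c' j) {i : ℕ} (hi : 1 ≤ i) (hij : i ≤ j) :
    G.lvl c' i = G.lvl c i := by
  refine filter_congr fun f hf => ?_
  have hf := mem_range.1 hf
  rw [h.sel]
  refine and_congr_right fun _ => ⟨fun h' => ?_, fun h' => ?_⟩
  · rw [← (h.level_eq hf (by omega)).1, h']
  · rw [h.level_eq_of_le hf (by omega), h']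

/-- The conditions on the first `j` levels, including maximality for `i < j`, refer to layers and
levels up to `j` only; disjointness and the cap are inherited by subsets. -/
theorem forest (h : G.Truncated c c' j) (hc : G.Forest c root j) : G.Forest c' root j := by
  refine ⟨?_, ?_, ?_, ?_, ?_, hc.root_mem, ?_, ?_⟩
  · intro e he f hf hes hfs
    rw [h.sel] at hes hfs
    exact hc.matching e he f hf hes hfs
  · intro e he f hf hel hfl
    rw [(h.layer_eq he hel).1] at hel
    rw [(h.layer_eq hf hfl).1] at hfl
    exact hc.layer_disj e he f hf hel hfl
  · intro e he hl hlj
    obtain ⟨h₁, h₂⟩ := h.layer_eq he hl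
    rw [h₁] at hl hlj ⊢
    have := hc.layer_level e he hl hlj
    rwa [h.level_eq_of_le he (by omega)]
  · intro v
    refine (card_le_card fun e he => ?_).trans (hc.cap v)
    obtain ⟨he, hl, hv⟩ := mem_filter.1 he
    rw [(h.layer_eq (mem_range.1 he) hl).1] at hl
    exact mem_filter.2 ⟨he, hl, hv⟩
  · intro e he f hf hl hlj hs hcf
    obtain ⟨h₁, h₂⟩ := h.layer_eq he hl
    rw [h₁] at hl hlj ⊢
    rw [h.sel] at hs
    have := hc.blocked e he f hf hl hlj hs hcf
    rwa [h.level_eq_of_le hf (by omega)]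
  · intro e he hl
    obtain ⟨h₁, h₂⟩ := h.level_eq he hl
    rw [h₁] at hl ⊢
    exact (hc.level_ne e he hl).imp_right fun h' => ⟨h'.1, (h.matched_iff _).2 h'.2⟩
  · intro i hi hij e he hl hli
    obtain ⟨h₁, h₂⟩ := h.level_eq he (by omega)
    rw [h₁] at hl hli
    rcases hc.maximal i hi hij e he hl hli with h' | ⟨f, hf, hcf, h'⟩
    · refine .inl (h'.trans (card_le_card fun f hf => ?_))
      obtain ⟨hf, h₃, h₄, h₅⟩ := mem_filter.1 hf
      refine mem_filter.2 ⟨hf, ?_⟩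
      rw [h.layer_eq_of_le (mem_range.1 hf) (by omega)]
      exact ⟨h₃, h₄, h₅⟩
    · refine .inr ⟨f, hf, hcf, ?_⟩
      rcases h' with h' | h'
      · left
        rwa [h.layer_eq_of_le hf (by omega)]
      · right
        rwa [h.level_eq_of_le hf (by omega), h.sel]

theorem rootOpen (h : G.Truncated c c' j) (hc : G.Forest c root j) (hj : 1 ≤ j)
    (hr : G.RootOpen c root) : G.RootOpen c' root := by
  obtain ⟨e, he, rfl⟩ := hc.root_mem
  exact ⟨by rw [h.level_eq_of_le he (by rw [hr.1]; exact hj), hr.1], by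
    rw [h.matched_iff]; exact hr.2⟩

end Truncated

/-! ### Building a layer -/

variable (G) in
/-- The edge `e` meets an addable edge or a selected edge of the tree. -/
def Hit (c : Config) (e : ℕ) : Prop :=
  ∃ f < G.m, G.Conf e f ∧ (c.layer f ≠ 0 ∨ c.sel f ≠ 0 ∧ c.level (G.vert f) ≠ 0)

variable (G) in
/-- The addable edges at the vertex `v`. -/
noncomputable def addable (c : Config) (v : ℕ) : Finset ℕ :=
  (range G.m).filter fun f => c.layer f ≠ 0 ∧ G.vert f = v

variable (G) in
/-- The configuration `c` arises from `c₀` by adding edges to layer `k + 1`, and the edges below `n`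
have been processed. -/
structure Greedy (c₀ c : Config) (k n : ℕ) : Prop where
  sel_eq : c.sel = c₀.sel
  level_eq : c.level = c₀.level
  layer : ∀ e < G.m, c.layer e = c₀.layer e ∨ c₀.layer e = 0 ∧ c.layer e = k + 1 ∧
    c.level (G.vert e) ≠ 0 ∧
    ∀ f < G.m, c.sel f ≠ 0 → c.level (G.vert f) ≠ 0 → ¬ G.Conf e f
  layer_disj : ∀ e < G.m, ∀ f < G.m, c.layer e ≠ 0 → c.layer f ≠ 0 → e ≠ f → ¬ G.Conf e f
  cap : ∀ v, (G.addable c v).card ≤ 16 * G.r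
  done : ∀ e < n, e < G.m → c.level (G.vert e) ≠ 0 →
    16 * G.r ≤ (G.addable c (G.vert e)).card ∨ G.Hit c e

theorem Greedy.init {c : Config} {root k : ℕ} (h : G.Forest c root k) : G.Greedy c c k 0 :=
  ⟨rfl, rfl, fun _ _ => .inl rfl, h.layer_disj, h.cap, fun e he => absurd he (Nat.not_lt_zero e)⟩

theorem Greedy.skip {c₀ c : Config} {k n : ℕ} (h : G.Greedy c₀ c k n)
    (h' : ¬ (c.level (G.vert n) ≠ 0 ∧ (G.addable c (G.vert n)).card < 16 * G.r ∧ ¬ G.Hit c n)) :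
    G.Greedy c₀ c k (n + 1) := by
  refine ⟨h.sel_eq, h.level_eq, h.layer, h.layer_disj, h.cap, fun e he hem hl => ?_⟩
  rcases Nat.lt_succ_iff_lt_or_eq.1 he with he | rfl
  · exact h.done e he hem hl
  · by_contra hcon
    push Not at hcon
    exact h' ⟨hl, hcon⟩

/-- Add the edge `e` to layer `i`. -/
noncomputable def _root_.Config.setLayer (c : Config) (e i : ℕ) : Config :=
  { c with layer := Function.update c.layer e i }

/-- Within a pass addable edges are only added, so the reasons for which earlier edges were rejected
persist; an added edge meets itself, which settles `done` for it. -/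
theorem Greedy.step {c₀ c : Config} {k n : ℕ} (h : G.Greedy c₀ c k n) (hn : n < G.m)
    (h₁ : c.level (G.vert n) ≠ 0) (h₂ : (G.addable c (G.vert n)).card < 16 * G.r)
    (h₃ : ¬ G.Hit c n) : G.Greedy c₀ (c.setLayer n (k + 1)) k (n + 1) := by
  have h₃' : ∀ f < G.m, G.Conf n f → c.layer f = 0 ∧ (c.sel f ≠ 0 → c.level (G.vert f) = 0) := by
    intro f hf hc
    by_contra hcon
    refine h₃ ⟨f, hf, hc, ?_⟩
    by_cases hl : c.layer f = 0
    · by_contra hcon'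
      exact hcon ⟨hl, by tauto⟩
    · exact .inl hl
  have hself : (c.setLayer n (k + 1)).layer n = k + 1 := by simp [Config.setLayer]
  have hne : ∀ f, f ≠ n → (c.setLayer n (k + 1)).layer f = c.layer f := by
    intro f hf
    simp [Config.setLayer, hf]
  have hmono : ∀ f, c.layer f ≠ 0 → (c.setLayer n (k + 1)).layer f ≠ 0 := by
    intro f hf
    by_cases hfn : f = n
    · rw [hfn, hself]
      omega
    · rwa [hne f hfn]
  have hsub : ∀ v, G.addable c v ⊆ G.addable (c.setLayer n (k + 1)) v := by
    intro v f hf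
    obtain ⟨hf, hl, hv⟩ := mem_filter.1 hf
    exact mem_filter.2 ⟨hf, hmono f hl, hv⟩
  refine ⟨h.sel_eq, h.level_eq, ?_, ?_, ?_, ?_⟩
  · intro e he
    by_cases hen : e = n
    · subst hen
      right
      refine ⟨?_, hself, h₁, fun f hf hs hl hc => hl ((h₃' f hf hc).2 hs)⟩
      have h0 := (h₃' e hn (G.refl e hn)).1
      rcases h.layer e he with h' | h' <;> omega
    · rw [hne e hen]
      exact h.layer e he
  · intro e he f hf hel hfl hef
    by_cases hen : e = n
    · subst hen
      rw [hne f (Ne.symm hef)] at hfl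
      exact fun hc => hfl (h₃' f hf hc).1
    · rw [hne e hen] at hel
      by_cases hfn : f = n
      · subst hfn
        exact fun hc => hel (h₃' e he (G.symm _ _ hc)).1
      · rw [hne f hfn] at hfl
        exact h.layer_disj e he f hf hel hfl hef
  · intro v
    by_cases hv : v = G.vert n
    · subst hv
      have : G.addable (c.setLayer n (k + 1)) (G.vert n) ⊆ insert n (G.addable c (G.vert n)) := by
        intro f hf
        obtain ⟨hf, hl, hv⟩ := mem_filter.1 hf
        by_cases hfn : f = n
        · rw [hfn]
          exact mem_insert_self _ _
        · rw [hne f hfn] at hl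
          exact mem_insert_of_mem (mem_filter.2 ⟨hf, hl, hv⟩)
      have h₄ := card_le_card this
      have h₅ := card_insert_le n (G.addable c (G.vert n))
      omega
    · refine (card_le_card fun f hf => ?_).trans (h.cap v)
      obtain ⟨hf, hl, hfv⟩ := mem_filter.1 hf
      rw [hne f (by rintro rfl; exact hv hfv.symm)] at hl
      exact mem_filter.2 ⟨hf, hl, hfv⟩
  · intro e he hem hl
    rcases Nat.lt_succ_iff_lt_or_eq.1 he with he | rfl
    · rcases h.done e he hem hl with h' | ⟨f, hf, hc, h'⟩
      · exact .inl (h'.trans (card_le_card (hsub _)))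
      · exact .inr ⟨f, hf, hc, h'.imp_left (hmono f)⟩
    · exact .inr ⟨e, hem, G.refl e hem, .inl (by rw [hself]; omega)⟩

variable (G) in
/-- The vertex `v` is covered by a selected edge among those below `n` that meets an addable
edge. -/
def Reached (c : Config) (n v : ℕ) : Prop :=
  ∃ f < n, f < G.m ∧ G.vert f = v ∧ c.sel f ≠ 0 ∧ ∃ e < G.m, c.layer e ≠ 0 ∧ G.Conf f e

variable (G) in
/-- The configuration `c'` arises from `c` by putting the reached vertices among those of the edges
below `n` on level `i`. -/
structure Leveled (c c' : Config) (i n : ℕ) : Prop where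
  sel : c'.sel = c.sel
  layer : c'.layer = c.layer
  level : ∀ v, c'.level v = if c.level v = 0 ∧ G.Reached c n v then i else c.level v

/-- The configuration after a new layer and a new level have been built. -/
theorem Greedy.grow {c₀ c c' : Config} {root k : ℕ} (hg : G.Greedy c₀ c k G.m)
    (hl : G.Leveled c c' (k + 1) G.m) (h : G.Forest c₀ root k) (hr : G.RootOpen c₀ root)
    (ht : G.Trimmed c₀ k) (hk : 1 ≤ k) :
    G.Forest c' root (k + 1) ∧ G.RootOpen c' root ∧ G.Trimmed c' (k + 1) ∧
      (∀ i, 1 ≤ i → i < k + 1 → G.lvl c' i = G.lvl c₀ i) ∧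
      ∀ v, G.Matched c' v ↔ G.Matched c₀ v := by
  have hsel : c'.sel = c₀.sel := hl.sel.trans hg.sel_eq
  have hmat : ∀ v, G.Matched c' v ↔ G.Matched c₀ v := by simp only [Matched, hsel, implies_true]
  have hold : ∀ v, c₀.level v ≠ 0 → c'.level v = c₀.level v := by
    intro v hv
    rw [hl.level, hg.level_eq, if_neg (by tauto)]
  have hlev : ∀ v, c'.level v = c₀.level v ∨
      c₀.level v = 0 ∧ c'.level v = k + 1 ∧ G.Reached c G.m v := by
    intro v
    rw [hl.level, hg.level_eq]
    split_ifs with h'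
    · exact .inr ⟨h'.1, rfl, h'.2⟩
    · exact .inl rfl
  have hlay : ∀ e < G.m, c₀.layer e ≠ 0 → c'.layer e = c₀.layer e := by
    intro e he h'
    rw [hl.layer]
    rcases hg.layer e he with h'' | h''
    · exact h''
    · exact absurd h''.1 h'
  refine ⟨⟨?_, ?_, ?_, ?_, ?_, h.root_mem, ?_, ?_⟩, ⟨?_, ?_⟩, ?_, ?_, hmat⟩
  · intro e he f hf hes hfs
    rw [hsel] at hes hfs
    exact h.matching e he f hf hes hfs
  · rw [hl.layer]
    exact hg.layer_disj
  · intro e he hle hlk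
    rw [hl.layer] at hle hlk ⊢
    rcases hg.layer e he with h' | h'
    · rw [h'] at hle ⊢
      have := h.layer_level e he hle (ht e he).1
      rw [hold _ (by omega)]
      exact this
    · have h'' := h'.2.2.1
      rw [hg.level_eq] at h''
      have := (ht e he).2
      rw [hold _ h'']
      omega
  · rw [hl.layer]
    exact hg.cap
  · intro e he f hf hle hlk hs hc
    rw [hl.layer] at hle ⊢
    rcases hg.layer e he with h' | h'
    · rw [h'] at hle ⊢
      rw [hsel] at hs
      have := h.blocked e he f hf hle (ht e he).1 hs hc
      rw [hold _ (by omega), this]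
    · rw [hl.sel] at hs
      -- A new addable edge avoids the selected edges of the old tree, so whatever blocks it was
      -- outside the tree and is placed on the new level.
      have h0 : c.level (G.vert f) = 0 := by
        by_contra hne
        exact h'.2.2.2 f hf hs hne hc
      rw [hl.level, if_pos ⟨h0, f, hf, hf, rfl, hs, e, he, hle, G.symm _ _ hc⟩, h'.2.1]
  · intro e he hle
    rcases hlev (G.vert e) with h' | ⟨-, h', f, -, hf, hfv, hs, -⟩
    · rw [h'] at hle ⊢
      exact (h.level_ne e he hle).imp_right fun h' => ⟨h'.1, (hmat _).2 h'.2⟩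
    · exact .inr ⟨by omega, f, hf, by rwa [hl.sel], hfv⟩
  · intro i hi hik e he hle hli
    have hle' : c'.level (G.vert e) = c₀.level (G.vert e) := by
      rcases hlev (G.vert e) with h' | h'
      · exact h'
      · omega
    rw [hle'] at hle hli
    rcases Nat.lt_succ_iff_lt_or_eq.1 hik with hik | rfl
    · rcases h.maximal i hi hik e he hle hli with h' | ⟨f, hf, hcf, h'⟩
      · refine .inl (h'.trans (card_le_card fun f hf => ?_))
        obtain ⟨hf, h₃, h₄, h₅⟩ := mem_filter.1 hf
        refine mem_filter.2 ⟨hf, ?_⟩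
        rw [hlay f (mem_range.1 hf) h₃]
        exact ⟨h₃, h₄, h₅⟩
      · refine .inr ⟨f, hf, hcf, ?_⟩
        rcases h' with h' | h'
        · left
          rwa [hlay f hf h'.1]
        · right
          rwa [hold _ (by omega), hsel]
    -- Maximality at the former last level is exactly what the completed greedy pass provides; the
    -- bound on layers is automatic.
    · have htop : ∀ f < G.m, c'.layer f ≤ i + 1 := by
        intro f hf
        rw [hl.layer]
        have := (ht f hf).1
        rcases hg.layer f hf with h' | h' <;> omega
      rcases hg.done e he he (by rw [hg.level_eq]; omega) with h' | ⟨f, hf, hcf, h'⟩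
      · refine .inl (h'.trans (card_le_card fun f hf => ?_))
        obtain ⟨hf, h₃, h₄⟩ := mem_filter.1 hf
        refine mem_filter.2 ⟨hf, ?_, htop f (mem_range.1 hf), h₄⟩
        rwa [hl.layer]
      · refine .inr ⟨f, hf, hcf, ?_⟩
        rcases h' with h' | h'
        · left
          exact ⟨by rwa [hl.layer], htop f hf⟩
        · right
          have h'' := h'.2
          rw [hg.level_eq] at h''
          have := (ht f hf).2
          rw [hold _ h'', hl.sel]
          exact ⟨h'.1, by omega, by omega⟩
  · rw [hold _ (by rw [hr.1]; omega), hr.1]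
  · rw [hmat]
    exact hr.2
  · intro e he
    have := ht e he
    constructor
    · rw [hl.layer]
      rcases hg.layer e he with h' | h' <;> omega
    · rcases hlev (G.vert e) with h' | h' <;> omega
  · intro i hi hik
    refine filter_congr fun f _ => ?_
    rw [hsel]
    refine and_congr_right fun _ => ?_
    rcases hlev (G.vert f) with h' | h' <;> omega

/-- A new tree, which consists of the root only. -/
theorem Forest.init {c : Config} {root : ℕ} (hm : G.IsMatching c) (hlay : ∀ e < G.m, c.layer e = 0)
    (hroot : ∃ e < G.m, G.vert e = root)
    (hlev : ∀ e < G.m, c.level (G.vert e) = if G.vert e = root then 1 else 0) :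
    G.Forest c root 1 ∧ G.Trimmed c 1 := by
  refine ⟨⟨hm, fun e he _ _ h => absurd (hlay e he) h, fun e he h => absurd (hlay e he) h,
    fun v => ?_, fun e he _ _ h => absurd (hlay e he) h, hroot, fun e he h => ?_,
    fun i hi hi1 => absurd hi1 (by omega)⟩, fun e he => ?_⟩
  · rw [Finset.card_eq_zero.2]
    · exact Nat.zero_le _
    · rw [filter_eq_empty_iff]
      rintro e he ⟨h, -⟩
      exact h (hlay e (mem_range.1 he))
  · rw [hlev e he] at h
    exact .inl (by simpa using h)
  · rw [hlay e he, hlev e he]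
    split_ifs <;> omega

end ConflictSystem

namespace ConflictSystem

/-! ### The potential -/

/-- The potential of a tree with `k` levels of sizes `y`. -/
def potential (k : ℕ) (y : ℕ → ℕ) : ℚ := ∑ i ∈ Ico 2 (k + 1), (1 / 2) ^ i * ((y i : ℚ) ^ 45)⁻¹

theorem potential_nonneg (k : ℕ) (y : ℕ → ℕ) : 0 ≤ potential k y :=
  sum_nonneg fun _ _ => by positivity

theorem sum_half_pow_Ico (j k : ℕ) (h : j ≤ k) :
    ∑ i ∈ Ico (j + 1) (k + 1), (1 / 2 : ℚ) ^ i = (1 / 2) ^ j - (1 / 2) ^ k := by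
  induction k, h using Nat.le_induction with
  | base => simp
  | succ k h ih => rw [sum_Ico_succ_top (by omega), ih, pow_succ]; ring

theorem inv_pow_le_inv_pow {a b : ℕ} (ha : 1 ≤ a) (h : a ≤ b) :
    ((b : ℚ) ^ 45)⁻¹ ≤ ((a : ℚ) ^ 45)⁻¹ := by
  have h1 : (0 : ℚ) < a := by exact_mod_cast ha
  have h2 : (a : ℚ) ≤ b := by exact_mod_cast h
  gcongr

theorem potential_le_one {k : ℕ} {y : ℕ → ℕ} (hy : ∀ i, 2 ≤ i → i ≤ k → 1 ≤ y i) :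
    potential k y ≤ 1 := by
  rcases Nat.lt_or_ge k 1 with hk | hk
  · rw [potential, Ico_eq_empty (by omega)]
    simp
  · have h : potential k y ≤ ∑ i ∈ Ico 2 (k + 1), (1 / 2 : ℚ) ^ i := by
      refine sum_le_sum fun i hi => mul_le_of_le_one_right (by positivity) ?_
      rw [mem_Ico] at hi
      simpa using inv_pow_le_inv_pow le_rfl (hy i hi.1 (by omega))
    rw [sum_half_pow_Ico 1 k hk] at h
    have : (0 : ℚ) ≤ (1 / 2) ^ k := by positivity
    linarith

/-- This dictates the exponent: `(64 / 63) ^ 45 ≥ 2`, so a collapse at least doubles the inverse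
power of the level size. -/
theorem two_mul_inv_pow_le {a b : ℕ} (ha : 1 ≤ a) (h : 64 * a ≤ 63 * b) :
    2 * ((b : ℚ) ^ 45)⁻¹ ≤ ((a : ℚ) ^ 45)⁻¹ := by
  have h1 : (0 : ℚ) < a := by exact_mod_cast ha
  have h2 : (64 / 63 : ℚ) * a ≤ b := by
    have : (64 * a : ℚ) ≤ 63 * b := by exact_mod_cast h
    linarith
  have h3 : 2 * (a : ℚ) ^ 45 ≤ (b : ℚ) ^ 45 := by
    calc 2 * (a : ℚ) ^ 45 ≤ (64 / 63 : ℚ) ^ 45 * (a : ℚ) ^ 45 := by gcongr; norm_num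
      _ = ((64 / 63 : ℚ) * a) ^ 45 := (mul_pow _ _ _).symm
      _ ≤ (b : ℚ) ^ 45 := by gcongr
  have h4 : (0 : ℚ) < (a : ℚ) ^ 45 := by positivity
  rw [← div_eq_mul_inv, ← one_div, div_le_div_iff₀ (by linarith) h4]
  linarith

/-- The sizes of the levels of a tree without levels that can be collapsed. -/
structure ValidSizes (m k : ℕ) (y : ℕ → ℕ) : Prop where
  one_le : 1 ≤ k
  two_pow_le : 2 ^ k ≤ m + 2
  le_m : ∀ i, y i ≤ m
  lt_succ : ∀ i, 1 ≤ i → i < k → y i < y (i + 1)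

namespace ValidSizes

variable {m k k' : ℕ} {y y' : ℕ → ℕ}

theorem mono (h : ValidSizes m k y) {i j : ℕ} (hi : 1 ≤ i) (hij : i ≤ j) (hj : j ≤ k) :
    y i ≤ y j := by
  induction j, hij using Nat.le_induction with
  | base => exact le_rfl
  | succ j hij ih => exact (ih (by omega)).trans (h.lt_succ j (by omega) (by omega)).le

theorem pos (h : ValidSizes m k y) {i : ℕ} (hi : 2 ≤ i) (hk : i ≤ k) : 1 ≤ y i := by
  obtain ⟨j, rfl⟩ : ∃ j, i = j + 1 := ⟨i - 1, by omega⟩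
  have := h.lt_succ j (by omega) (by omega)
  omega

/-- The guaranteed progress of a round: `2 ^ k ≤ m + 2` and `y i ≤ m` keep each term away from 0. -/
theorem le_term (h : ValidSizes m k y) {i : ℕ} (hi : 2 ≤ i) (hk : i ≤ k) :
    ((m + 2 : ℚ) * (m : ℚ) ^ 45)⁻¹ ≤ (1 / 2) ^ k * ((y i : ℚ) ^ 45)⁻¹ := by
  rw [mul_inv]
  have h1 : ((m + 2 : ℚ))⁻¹ ≤ (1 / 2) ^ k := by
    rw [one_div, inv_pow]
    have : (2 : ℚ) ^ k ≤ m + 2 := by exact_mod_cast h.two_pow_le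
    gcongr
  have h2 := inv_pow_le_inv_pow (h.pos hi hk) (h.le_m i)
  gcongr

/-- Every round of the search increases the potential. -/
theorem potential_lt (h : ValidSizes m k y) (h' : ValidSizes m k' y') (hkk : k' ≤ k + 1)
    (heq : ∀ i, 1 ≤ i → i < k' → y' i = y i)
    (hlast : k' = k + 1 ∨ 2 ≤ k' ∧ 64 * y' k' ≤ 63 * y k') :
    potential k y + ((m + 2 : ℚ) * (m : ℚ) ^ 45)⁻¹ ≤ potential k' y' := by
  have hk := h.one_le
  by_cases hext : k' = k + 1
  · subst hext
    have h1 : potential (k + 1) y' = potential k y + (1 / 2) ^ (k + 1) * ((y' (k + 1) : ℚ) ^ 45)⁻¹ := by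
      rw [potential, sum_Ico_succ_top (by omega)]
      congr 1
      refine sum_congr rfl fun i hi => ?_
      rw [mem_Ico] at hi
      rw [heq i (by omega) (by omega)]
    rw [h1]
    have := h'.le_term (i := k + 1) (by omega) le_rfl
    linarith
  -- After a collapse at level `k'` its term has gained at least `2 ^ (-k') * (y k') ^ (-45)`. Sizes
  -- increase with the level, so the discarded terms amount to at most `(2 ^ (-k') - 2 ^ (-k)) * (y
  -- k') ^ (-45)`. The difference is bounded below by `le_term`.
  · obtain ⟨h2, h3⟩ := hlast.resolve_left hext
    have hsplit : potential k y = ∑ i ∈ Ico 2 k', (1 / 2) ^ i * ((y i : ℚ) ^ 45)⁻¹ +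
        (1 / 2) ^ k' * ((y k' : ℚ) ^ 45)⁻¹ +
        ∑ i ∈ Ico (k' + 1) (k + 1), (1 / 2) ^ i * ((y i : ℚ) ^ 45)⁻¹ := by
      rw [potential, ← sum_Ico_succ_top (by omega), sum_Ico_consecutive _ (by omega) (by omega)]
    have hnew : potential k' y' = ∑ i ∈ Ico 2 k', (1 / 2) ^ i * ((y i : ℚ) ^ 45)⁻¹ +
        (1 / 2) ^ k' * ((y' k' : ℚ) ^ 45)⁻¹ := by
      rw [potential, sum_Ico_succ_top (by omega)]
      congr 1
      refine sum_congr rfl fun i hi => ?_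
      rw [mem_Ico] at hi
      rw [heq i (by omega) (by omega)]
    have htail : ∑ i ∈ Ico (k' + 1) (k + 1), (1 / 2) ^ i * ((y i : ℚ) ^ 45)⁻¹ ≤
        ((1 / 2) ^ k' - (1 / 2) ^ k) * ((y k' : ℚ) ^ 45)⁻¹ := by
      rw [← sum_half_pow_Ico k' k (by omega), sum_mul]
      refine sum_le_sum fun i hi => ?_
      rw [mem_Ico] at hi
      have := inv_pow_le_inv_pow (h.pos h2 (by omega))
        (h.mono (i := k') (j := i) (by omega) (by omega) (by omega))
      gcongr
    have h4 := two_mul_inv_pow_le (h'.pos h2 le_rfl) h3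
    have h5 := h.le_term (i := k') h2 (by omega)
    have h6 : (0 : ℚ) ≤ (1 / 2) ^ k' := by positivity
    have h7 := mul_le_mul_of_nonneg_left h4 h6
    rw [hsplit, hnew]
    linarith

end ValidSizes

/-- The number of rounds that are left. -/
def roundsLeft (m k : ℕ) (y : ℕ → ℕ) : ℕ :=
  ⌊(1 - potential k y) * ((m + 2 : ℚ) * (m : ℚ) ^ 45)⌋₊

theorem roundsLeft_le (m k : ℕ) (y : ℕ → ℕ) : roundsLeft m k y ≤ (m + 2) * m ^ 45 := by
  refine Nat.floor_le_of_le ?_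
  push_cast
  refine mul_le_of_le_one_left (by positivity) ?_
  have := potential_nonneg k y
  linarith

/-- The scaling turns the minimal gain of the potential into 1, so the integer part drops as well;
this is the variant of the search loop. -/
theorem ValidSizes.roundsLeft_lt {m k k' : ℕ} {y y' : ℕ → ℕ} (h : ValidSizes m k y)
    (h' : ValidSizes m k' y') (hm : 1 ≤ m) (hkk : k' ≤ k + 1)
    (heq : ∀ i, 1 ≤ i → i < k' → y' i = y i)
    (hlast : k' = k + 1 ∨ 2 ≤ k' ∧ 64 * y' k' ≤ 63 * y k') :
    roundsLeft m k' y' < roundsLeft m k y := by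
  have h1 := h.potential_lt h' hkk heq hlast
  have h2 := potential_le_one (k := k') (y := y') fun i hi hk => h'.pos hi hk
  have hm' : (0 : ℚ) < m := by exact_mod_cast hm
  have hD : (0 : ℚ) < (m + 2 : ℚ) * (m : ℚ) ^ 45 := by positivity
  have h3 : (1 - potential k' y') * ((m + 2 : ℚ) * (m : ℚ) ^ 45) + 1 ≤
      (1 - potential k y) * ((m + 2 : ℚ) * (m : ℚ) ^ 45) := by
    have := mul_le_mul_of_nonneg_right h1 hD.le
    rw [add_mul, inv_mul_cancel₀ hD.ne'] at this
    linarith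
  rw [← Nat.add_one_le_iff, roundsLeft, roundsLeft, ← Nat.floor_add_one (by
    have : 0 ≤ 1 - potential k' y' := by linarith
    positivity)]
  exact Nat.floor_le_floor h3

end ConflictSystem

/-! ### Programs for building a layer and a level -/

namespace RAM

open Classical

/-- The configuration of the search that a memory holds. -/
def State.cfg (s : State) : Config := ⟨s.arr 3, s.arr 6, s.arr 7⟩

/-- The `A`-vertex of the edge in register `x`. -/
def vertE (x : ℕ) : Expr := .get 0 (.reg x)

/-- The level of the `A`-vertex of the edge in register `x`. -/
def levelE (x : ℕ) : Expr := .get 7 (vertE x)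

/-- Whether the edge in register `x` meets the edge in register `y` on the `B`-side. -/
def confE (x y : ℕ) : Expr := .get 4 (.add (.get 5 (.reg x)) (.reg y))

/-- The memory holds the conflict system `G`. -/
structure Env (G : ConflictSystem) (s : State) : Prop where
  m : s.reg 0 = G.m
  r : s.reg 1 = G.r
  vert : s.arr 0 = G.vert
  conf : ∀ e < G.m, ∀ f < G.m, s.arr 4 (s.arr 5 e + f) ≠ 0 ↔ G.Conf e f

theorem Env.frame {G : ConflictSystem} {P : Prog} {s s' : State} (h : Env G s)
    (hf : Frame P s s') (hP : P.setsReg 0 = false ∧ P.setsReg 1 = false ∧ P.setsArr 0 = false ∧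
      P.setsArr 4 = false ∧ P.setsArr 5 = false) : Env G s' := by
  obtain ⟨h₁, h₂, h₃, h₄, h₅⟩ := hP
  exact ⟨(hf.1 0 h₁).trans h.m, (hf.1 1 h₂).trans h.r, (hf.2 0 h₃).trans h.vert, by
    rw [hf.2 4 h₄, hf.2 5 h₅]; exact h.conf⟩

variable {G : ConflictSystem} {N : ℕ} {s : State}

theorem eval_vertE (hE : Env G s) (x : ℕ) : (vertE x).eval s = G.vert (s.reg x) := by
  simp [vertE, hE.vert]

theorem eval_levelE (hE : Env G s) (x : ℕ) :
    (levelE x).eval s = s.cfg.level (G.vert (s.reg x)) := by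
  simp [levelE, eval_vertE hE, State.cfg]

theorem eval_confE (hE : Env G s) {x y : ℕ} (hx : s.reg x < G.m) (hy : s.reg y < G.m) :
    (confE x y).eval s = 0 ↔ ¬ G.Conf (s.reg x) (s.reg y) := by
  rw [← hE.conf _ hx _ hy, not_not]
  rfl

theorem eval_sel (x : ℕ) : (Expr.get 3 (.reg x)).eval s = s.cfg.sel (s.reg x) := rfl

theorem eval_layer (x : ℕ) : (Expr.get 6 (.reg x)).eval s = s.cfg.layer (s.reg x) := rfl

theorem cfg_eq_of_frame {P : Prog} {s' : State} (hf : Frame P s s')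
    (hP : P.setsArr 3 = false ∧ P.setsArr 6 = false ∧ P.setsArr 7 = false) : s'.cfg = s.cfg := by
  simp [State.cfg, hf.2 3 hP.1, hf.2 6 hP.2.1, hf.2 7 hP.2.2]

/-- Sixteen times register `1`. -/
def capE : Expr :=
  .add (.add (.add (.add (.reg 1) (.reg 1)) (.add (.reg 1) (.reg 1)))
    (.add (.add (.reg 1) (.reg 1)) (.add (.reg 1) (.reg 1))))
    (.add (.add (.add (.reg 1) (.reg 1)) (.add (.reg 1) (.reg 1)))
    (.add (.add (.reg 1) (.reg 1)) (.add (.reg 1) (.reg 1))))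

theorem eval_capE (hE : Env G s) : capE.eval s = 16 * G.r := by
  simp only [capE, Expr.eval_add, Expr.eval_reg, hE.r]
  omega

/-- Count the addable edges at the vertex of the edge in register `2`. -/
def countAddable : Prog :=
  countLoop 3 5 (.and (.get 6 (.reg 3)) (.eq (vertE 3) (vertE 2)))

/-- Test whether the edge in register `2` meets an addable edge or an edge of the tree. -/
def testHit : Prog :=
  anyLoop 3 4 (.and (confE 2 3) (.add (.get 6 (.reg 3)) (.and (.get 3 (.reg 3)) (levelE 3))))

/-- Test whether the edge in register `2` meets a selected edge. -/
def testBlocked : Prog :=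
  anyLoop 3 4 (.and (.get 3 (.reg 3)) (confE 2 3))

/-- Test whether the edge in register `2` meets an addable edge. -/
def testReached : Prog :=
  anyLoop 3 4 (.and (.get 6 (.reg 3)) (confE 2 3))

theorem runs_countAddable (hE : Env G s) (hN : G.m ≤ N) :
    Runs N countAddable s fun s' =>
      s'.reg 5 = (G.addable s.cfg (G.vert (s.reg 2))).card := by
  refine Runs.countLoop (fun f => s.cfg.layer f ≠ 0 ∧ G.vert f = G.vert (s.reg 2))
    (by rwa [hE.m]) (by decide) (by decide) (by decide) ?_ ?_
  · rintro i s' hi hf rfl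
    have hE' := hE.frame hf ⟨rfl, rfl, rfl, rfl, rfl⟩
    have h2 : s'.reg 2 = s.reg 2 := hf.1 2 rfl
    have hc : s'.cfg = s.cfg := cfg_eq_of_frame hf ⟨rfl, rfl, rfl⟩
    simp [eval_layer, eval_vertE hE', h2, hc, -Expr.eval_get]
  · intro s' hf h
    rw [h, hE.m]
    simp only [ConflictSystem.addable]
    congr!

theorem runs_testHit (hE : Env G s) (hN : G.m ≤ N) (h2 : s.reg 2 < G.m) :
    Runs N testHit s fun s' => s'.reg 4 ≠ 0 ↔ G.Hit s.cfg (s.reg 2) := by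
  refine Runs.anyLoop (fun f => G.Conf (s.reg 2) f ∧
    (s.cfg.layer f ≠ 0 ∨ s.cfg.sel f ≠ 0 ∧ s.cfg.level (G.vert f) ≠ 0))
    (by rwa [hE.m]) (by decide) (by decide) (by decide) ?_ ?_
  · rintro i s' hi hf rfl
    have hE' := hE.frame hf ⟨rfl, rfl, rfl, rfl, rfl⟩
    have h2' : s'.reg 2 = s.reg 2 := hf.1 2 rfl
    have hc : s'.cfg = s.cfg := cfg_eq_of_frame hf ⟨rfl, rfl, rfl⟩
    rw [hE.m] at hi
    have h₁ := eval_confE hE' (x := 2) (y := 3) (by omega) hi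
    simp [eval_layer, eval_sel, eval_levelE hE', h2', hc, -Expr.eval_get, h₁]
    tauto
  · intro s' hf h
    rw [h, hE.m]
    rfl

theorem runs_testBlocked (hE : Env G s) (hN : G.m ≤ N) (h2 : s.reg 2 < G.m) :
    Runs N testBlocked s fun s' => s'.reg 4 ≠ 0 ↔ ¬ G.Free s.cfg (s.reg 2) := by
  refine Runs.anyLoop (fun f => s.cfg.sel f ≠ 0 ∧ G.Conf (s.reg 2) f)
    (by rwa [hE.m]) (by decide) (by decide) (by decide) ?_ ?_
  · rintro i s' hi hf rfl
    have hE' := hE.frame hf ⟨rfl, rfl, rfl, rfl, rfl⟩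
    have h2' : s'.reg 2 = s.reg 2 := hf.1 2 rfl
    have hc : s'.cfg = s.cfg := cfg_eq_of_frame hf ⟨rfl, rfl, rfl⟩
    rw [hE.m] at hi
    have h₁ := eval_confE hE' (x := 2) (y := 3) (by omega) hi
    simp [eval_sel, h2', hc, -Expr.eval_get, h₁]
  · intro s' hf h
    rw [h, hE.m, ConflictSystem.Free]
    push Not
    rfl

theorem runs_testReached (hE : Env G s) (hN : G.m ≤ N) (h2 : s.reg 2 < G.m) :
    Runs N testReached s fun s' => s'.reg 4 ≠ 0 ↔
      ∃ e < G.m, s.cfg.layer e ≠ 0 ∧ G.Conf (s.reg 2) e := by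
  refine Runs.anyLoop (fun f => s.cfg.layer f ≠ 0 ∧ G.Conf (s.reg 2) f)
    (by rwa [hE.m]) (by decide) (by decide) (by decide) ?_ ?_
  · rintro i s' hi hf rfl
    have hE' := hE.frame hf ⟨rfl, rfl, rfl, rfl, rfl⟩
    have h2' : s'.reg 2 = s.reg 2 := hf.1 2 rfl
    have hc : s'.cfg = s.cfg := cfg_eq_of_frame hf ⟨rfl, rfl, rfl⟩
    rw [hE.m] at hi
    have h₁ := eval_confE hE' (x := 2) (y := 3) (by omega) hi
    simp [eval_layer, h2', hc, -Expr.eval_get, h₁]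
  · intro s' hf h
    rw [h, hE.m]

/-- Add the edge in register `2` to the new layer if possible. -/
def addEdge : Prog :=
  .branch (levelE 2)
    (.seq countAddable (.seq testHit
      (.branch (.and (.lt (.reg 5) capE) (.not (.reg 4)))
        (.store 6 (.reg 2) (.add (.reg 6) (.const 1))) .skip)))
    .skip

/-- Build a new layer. -/
def buildLayer : Prog := forLoop 2 0 addEdge

theorem runs_buildLayer (hE : Env G s) (hN : G.m ≤ N) {root : ℕ}
    (h : G.Forest s.cfg root (s.reg 6)) :
    Runs N buildLayer s fun s' => G.Greedy s.cfg s'.cfg (s.reg 6) G.m := by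
  refine Runs.forLoop (fun n s' => G.Greedy s.cfg s'.cfg (s.reg 6) n) (by rwa [hE.m])
    rfl rfl (by decide) (.init h) ?_ fun s' _ _ hs' => by rwa [hE.m] at hs'
  rintro i s' hi hf hx hs'
  have hE' := hE.frame hf ⟨rfl, rfl, rfl, rfl, rfl⟩
  have h6 : s'.reg 6 = s.reg 6 := hf.1 6 rfl
  rw [hE.m] at hi
  refine Runs.branch (fun hl => ?_) fun hl => Runs.skip ?_
  · rw [eval_levelE hE', hx] at hl
    refine Runs.seq ((runs_countAddable hE' hN).mono fun s₁ hf₁ h₁ => Runs.seq ?_)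
    have hE₁ := hE'.frame hf₁ ⟨rfl, rfl, rfl, rfl, rfl⟩
    have hx₁ : s₁.reg 2 = i := (hf₁.1 2 rfl).trans hx
    have hc₁ : s₁.cfg = s'.cfg := cfg_eq_of_frame hf₁ ⟨rfl, rfl, rfl⟩
    refine (runs_testHit hE₁ hN (by omega)).mono fun s₂ hf₂ h₂ => ?_
    have hE₂ := hE₁.frame hf₂ ⟨rfl, rfl, rfl, rfl, rfl⟩
    have hx₂ : s₂.reg 2 = i := (hf₂.1 2 rfl).trans hx₁
    have hc₂ : s₂.cfg = s'.cfg := (cfg_eq_of_frame hf₂ ⟨rfl, rfl, rfl⟩).trans hc₁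
    have h5 : s₂.reg 5 = s₁.reg 5 := hf₂.1 5 rfl
    have h6' : s₂.reg 6 = s.reg 6 := (hf₂.1 6 rfl).trans ((hf₁.1 6 rfl).trans h6)
    rw [hc₁, hx₁] at h₂
    rw [hx] at h₁
    refine Runs.branch (fun ha => Runs.store ?_) fun ha => Runs.skip ?_
    · simp only [ne_eq, Expr.eval_and_eq_zero, Expr.eval_lt_eq_zero, Expr.eval_not_eq_zero,
        Expr.eval_reg, eval_capE hE₂, not_not] at ha
      rw [h5, h₁] at ha
      have h₃ := hs'.step hi hl ha.1 (by rw [← h₂]; simpa using ha.2)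
      convert h₃ using 1
      simp only [State.cfg, Config.setLayer, State.setReg_arr, Expr.eval_reg, Expr.eval_add,
        Expr.eval_const, hx₂, h6', State.setArr_arr_self]
      rw [State.setArr_arr_of_ne _ _ _ (by decide), State.setArr_arr_of_ne _ _ _ (by decide)]
      have := hc₂
      simp only [State.cfg, Config.mk.injEq] at this
      simp [this]
    · simp only [Expr.eval_and_eq_zero, Expr.eval_lt_eq_zero, Expr.eval_not_eq_zero,
        Expr.eval_reg, eval_capE hE₂, ne_eq, not_not] at ha
      rw [h5, h₁] at ha
      change G.Greedy s.cfg s₂.cfg _ _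
      rw [hc₂]
      refine hs'.skip fun hcon => ha ⟨hcon.2.1, ?_⟩
      by_contra hne
      exact hcon.2.2 (h₂.1 hne)
  · rw [eval_levelE hE', hx] at hl
    exact hs'.skip fun hcon => hcon.1 hl

/-- Put the vertex of the edge in register `2` on the new level if it is reached. -/
def addVertex : Prog :=
  .branch (.and (.get 3 (.reg 2)) (.not (levelE 2)))
    (.seq testReached (.branch (.reg 4) (.store 7 (vertE 2) (.add (.reg 6) (.const 1))) .skip))
    .skip

/-- Build a new level. -/
def buildLevel : Prog := forLoop 2 0 addVertex

theorem reached_succ {c : Config} {n v : ℕ} (hn : n < G.m) :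
    G.Reached c (n + 1) v ↔ G.Reached c n v ∨
      G.vert n = v ∧ c.sel n ≠ 0 ∧ ∃ e < G.m, c.layer e ≠ 0 ∧ G.Conf n e := by
  constructor
  · rintro ⟨f, hf, h⟩
    rcases Nat.lt_succ_iff_lt_or_eq.1 hf with hf | rfl
    · exact .inl ⟨f, hf, h⟩
    · exact .inr h.2
  · rintro (⟨f, hf, h⟩ | h)
    · exact ⟨f, by omega, h⟩
    · exact ⟨n, by omega, hn, h⟩

theorem runs_buildLevel (hE : Env G s) (hN : G.m ≤ N) :
    Runs N buildLevel s fun s' => G.Leveled s.cfg s'.cfg (s.reg 6 + 1) G.m := by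
  refine Runs.forLoop (fun n s' => ∀ v, s'.cfg.level v =
      if s.cfg.level v = 0 ∧ G.Reached s.cfg n v then s.reg 6 + 1 else s.cfg.level v)
    (by rwa [hE.m]) rfl rfl (by decide) ?_ ?_ ?_
  · intro v
    rw [if_neg]
    · rfl
    · rintro ⟨-, f, hf, -⟩
      exact absurd hf (Nat.not_lt_zero f)
  · rintro i s' hi hf hx hs'
    have hE' := hE.frame hf ⟨rfl, rfl, rfl, rfl, rfl⟩
    have h6 : s'.reg 6 = s.reg 6 := hf.1 6 rfl
    have hsel : s'.cfg.sel = s.cfg.sel := hf.2 3 rfl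
    have hlay : s'.cfg.layer = s.cfg.layer := hf.2 6 rfl
    rw [hE.m] at hi
    -- Nothing needs to be written when the vertex was in the old tree, when the edge is not a
    -- selected edge meeting an addable one, or when an earlier edge has already put the vertex on
    -- the new level. The program tests current levels, the invariant refers to the old ones.
    have hstay : (s.cfg.level (G.vert i) = 0 → s.cfg.sel i ≠ 0 →
        (∃ e < G.m, s.cfg.layer e ≠ 0 ∧ G.Conf i e) → G.Reached s.cfg i (G.vert i)) →
        ∀ v, s'.cfg.level v =
      if s.cfg.level v = 0 ∧ G.Reached s.cfg (i + 1) v then s.reg 6 + 1 else s.cfg.level v := by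
      intro h v
      rw [hs' v]
      refine if_congr (and_congr_right fun hv => ?_) rfl rfl
      rw [reached_succ hi]
      refine ⟨.inl, fun h' => h'.elim id ?_⟩
      rintro ⟨rfl, h₁, h₂⟩
      exact h hv h₁ h₂
    refine Runs.branch (fun ha => Runs.seq ?_) fun ha => Runs.skip ?_
    · simp only [ne_eq, Expr.eval_and_eq_zero, Expr.eval_not_eq_zero, eval_sel, eval_levelE hE',
        hx, not_not] at ha
      refine (runs_testReached hE' hN (by omega)).mono fun s₁ hf₁ h₁ => ?_
      have hE₁ := hE'.frame hf₁ ⟨rfl, rfl, rfl, rfl, rfl⟩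
      have hx₁ : s₁.reg 2 = i := (hf₁.1 2 rfl).trans hx
      have hc₁ : s₁.cfg = s'.cfg := cfg_eq_of_frame hf₁ ⟨rfl, rfl, rfl⟩
      have h6' : s₁.reg 6 = s.reg 6 := (hf₁.1 6 rfl).trans h6
      rw [hx, hlay] at h₁
      rw [hsel] at ha
      have hl₀ : s.cfg.level (G.vert i) = 0 := by
        have := hs' (G.vert i)
        rw [ha.2] at this
        split_ifs at this
        exact this.symm
      refine Runs.branch (fun hb => Runs.store ?_) fun hb => Runs.skip ?_
      · intro v
        have : ((s₁.setArr 7 ((vertE 2).eval s₁)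
            ((Expr.add (.reg 6) (.const 1)).eval s₁)).setReg 2 (i + 1)).cfg.level v =
            if v = G.vert i then s.reg 6 + 1 else s'.cfg.level v := by
          rw [← hc₁]
          simp [State.cfg, eval_vertE hE₁, hx₁, h6', Function.update_apply]
        rw [this]
        by_cases hv : v = G.vert i
        · rw [if_pos hv, if_pos]
          subst hv
          exact ⟨hl₀, (reached_succ hi).2 (.inr ⟨rfl, ha.1, h₁.1 hb⟩)⟩
        · rw [if_neg hv, hs' v]
          refine if_congr (and_congr_right fun _ => ?_) rfl rfl
          rw [reached_succ hi]
          exact ⟨.inl, fun h' => h'.resolve_right fun h'' => hv h''.1.symm⟩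
      · change ∀ v, s₁.cfg.level v = _
        rw [hc₁]
        exact hstay fun _ _ h => absurd hb (h₁.2 h)
    · simp only [Expr.eval_and_eq_zero, Expr.eval_not_eq_zero, eval_sel, eval_levelE hE',
        hx, ne_eq, not_not, hsel] at ha
      refine hstay fun h₁ h₂ _ => ?_
      by_contra hr
      have := hs' (G.vert i)
      rw [if_neg (by tauto), h₁] at this
      exact ha ⟨h₂, this⟩
  · intro s' hf _ hs'
    rw [hE.m] at hs'
    exact ⟨hf.2 3 rfl, hf.2 6 rfl, hs'⟩

/-- Build a new layer and a new level. -/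
def build : Prog := .seq buildLayer (.seq buildLevel (.assign 6 (.add (.reg 6) (.const 1))))

theorem runs_build (hE : Env G s) (hN : G.m ≤ N) {root : ℕ}
    (h : G.Forest s.cfg root (s.reg 6)) (hr : G.RootOpen s.cfg root)
    (ht : G.Trimmed s.cfg (s.reg 6)) (hk : 1 ≤ s.reg 6) :
    Runs N build s fun s' => s'.reg 6 = s.reg 6 + 1 ∧
      G.Forest s'.cfg root (s.reg 6 + 1) ∧ G.RootOpen s'.cfg root ∧
      G.Trimmed s'.cfg (s.reg 6 + 1) ∧
      (∀ i, 1 ≤ i → i < s.reg 6 + 1 → G.lvl s'.cfg i = G.lvl s.cfg i) ∧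
      ∀ v, G.Matched s'.cfg v ↔ G.Matched s.cfg v := by
  refine Runs.seq ((runs_buildLayer hE hN h).mono fun s₁ hf₁ h₁ => Runs.seq ?_)
  have h6 : s₁.reg 6 = s.reg 6 := hf₁.1 6 rfl
  refine (runs_buildLevel (hE.frame hf₁ ⟨rfl, rfl, rfl, rfl, rfl⟩) hN).mono
    fun s₂ hf₂ h₂ => Runs.assign ?_
  have h6' : s₂.reg 6 = s.reg 6 := (hf₂.1 6 rfl).trans h6
  rw [h6] at h₂
  have := h₁.grow h₂ h hr ht hk
  exact ⟨by simp [h6'], this⟩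

end RAM

/-! ### Measuring and collapsing levels, rounds of the search -/

namespace ConflictSystem

variable {G : ConflictSystem}

theorem Forest.mono {c : Config} {root j k : ℕ} (h : G.Forest c root k) (hjk : j ≤ k) :
    G.Forest c root j :=
  ⟨h.matching, h.layer_disj, fun e he hl hlj => h.layer_level e he hl (hlj.trans hjk), h.cap,
    fun e he f hf hl hlj => h.blocked e he f hf hl (hlj.trans hjk), h.root_mem, h.level_ne,
    fun i hi hij => h.maximal i hi (hij.trans_le hjk)⟩

variable (G) in
/-- A search tree with `k` levels. -/
structure Tree (c : Config) (root k : ℕ) : Prop where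
  forest : G.Forest c root k
  rootOpen : G.RootOpen c root
  trimmed : G.Trimmed c k

theorem Tree.validSizes {c : Config} {root k : ℕ} (h : G.Tree c root k) (hk : 1 ≤ k)
    (hq : ∀ i, 1 ≤ i → G.Quiet c i) : ValidSizes G.m k fun i => (G.lvl c i).card :=
  have h' := h.forest.sizes h.rootOpen (fun j hj _ => hq j hj) hk
  ⟨hk, h'.1, fun _ => card_lvl_le _ _, h'.2⟩

end ConflictSystem

namespace RAM

open Classical

variable {G : ConflictSystem} {N : ℕ} {s : State}

/-- Compute four times the number of free addable edges and `r` times the number of selected edges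
at the level in register `7`. -/
def measureLevel : Prog :=
  .seq (.assign 8 (.const 0)) (.seq (.assign 9 (.const 0)) (forLoop 2 0 (.seq testBlocked (.seq
    (.branch (.and (.get 6 (.reg 2)) (.and (.eq (levelE 2) (.reg 7)) (.not (.reg 4))))
      (.assign 8 (.add (.reg 8) (.const 4))) .skip)
    (.branch (.and (.get 3 (.reg 2)) (.eq (levelE 2) (.reg 7)))
      (.assign 9 (.add (.reg 9) (.reg 1))) .skip)))))

theorem Env.setReg (hE : Env G s) {x v : ℕ} (h0 : x ≠ 0) (h1 : x ≠ 1) : Env G (s.setReg x v) :=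
  ⟨by simp [hE.m, h0.symm], by simp [hE.r, h1.symm], hE.vert, hE.conf⟩

theorem card_filter_range_succ (p : ℕ → Prop) [DecidablePred p] (n : ℕ) :
    ((range (n + 1)).filter p).card = ((range n).filter p).card + if p n then 1 else 0 := by
  rw [range_add_one, filter_insert]
  split_ifs <;> simp

theorem runs_measureLevel (hE : Env G s) (hN : G.m ≤ N) :
    Runs N measureLevel s fun s' => s'.reg 8 = 4 * (G.freeAt s.cfg (s.reg 7)).card ∧
      s'.reg 9 = G.r * (G.lvl s.cfg (s.reg 7)).card := by
  refine Runs.seq (Runs.assign (Runs.seq (Runs.assign ?_)))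
  set s₀ := (s.setReg 8 ((Expr.const 0).eval s)).setReg 9
    ((Expr.const 0).eval (s.setReg 8 ((Expr.const 0).eval s))) with hs₀
  have hE₀ : Env G s₀ := (hE.setReg (by decide) (by decide)).setReg (by decide) (by decide)
  have hc₀ : s₀.cfg = s.cfg := rfl
  have h7₀ : s₀.reg 7 = s.reg 7 := by simp [hs₀]
  set p : ℕ → Prop := fun e => s.cfg.layer e ≠ 0 ∧ s.cfg.level (G.vert e) = s.reg 7 ∧
    G.Free s.cfg e with hp
  set q : ℕ → Prop := fun e => s.cfg.sel e ≠ 0 ∧ s.cfg.level (G.vert e) = s.reg 7 with hq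
  -- There is no multiplication, so the products are accumulated in increments of `4` and of `r`.
  refine Runs.forLoop (fun n s' => s'.reg 8 = 4 * ((range n).filter p).card ∧
    s'.reg 9 = G.r * ((range n).filter q).card) (by rwa [hE₀.m]) rfl rfl (by decide) ?_ ?_ ?_
  · simp [hs₀]
  · rintro i s' hi hf hx ⟨h8, h9⟩
    have hE' := hE₀.frame hf ⟨rfl, rfl, rfl, rfl, rfl⟩
    have hc' : s'.cfg = s.cfg := (cfg_eq_of_frame hf ⟨rfl, rfl, rfl⟩).trans hc₀
    have h7' : s'.reg 7 = s.reg 7 := (hf.1 7 rfl).trans h7₀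
    rw [hE₀.m] at hi
    refine Runs.seq ((runs_testBlocked hE' hN (by omega)).mono fun s₁ hf₁ h₁ => Runs.seq ?_)
    have hE₁ := hE'.frame hf₁ ⟨rfl, rfl, rfl, rfl, rfl⟩
    have hx₁ : s₁.reg 2 = i := (hf₁.1 2 rfl).trans hx
    have hc₁ : s₁.cfg = s.cfg := (cfg_eq_of_frame hf₁ ⟨rfl, rfl, rfl⟩).trans hc'
    have h7₁ : s₁.reg 7 = s.reg 7 := (hf₁.1 7 rfl).trans h7'
    have h8₁ : s₁.reg 8 = 4 * ((range i).filter p).card := (hf₁.1 8 rfl).trans h8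
    have h9₁ : s₁.reg 9 = G.r * ((range i).filter q).card := (hf₁.1 9 rfl).trans h9
    rw [hc', hx] at h₁
    have hpi : (Expr.and (.get 6 (.reg 2)) (.and (.eq (levelE 2) (.reg 7)) (.not (.reg 4)))).eval s₁
        = 0 ↔ ¬ p i := by
      simp only [Expr.eval_and_eq_zero, eval_layer, Expr.eval_eq_eq_zero, eval_levelE hE₁,
        Expr.eval_not_eq_zero, Expr.eval_reg, hc₁, hx₁, h7₁, hp, ne_eq, not_not]
      have : s₁.reg 4 = 0 ↔ G.Free s.cfg i := by
        have := not_congr h₁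
        rwa [not_ne_iff, not_not] at this
      rw [this]
    have hmid : Runs N (.branch (.and (.get 6 (.reg 2)) (.and (.eq (levelE 2) (.reg 7))
        (.not (.reg 4)))) (.assign 8 (.add (.reg 8) (.const 4))) .skip) s₁
        fun s' => s'.reg 8 = 4 * ((range (i + 1)).filter p).card := by
      refine Runs.branch (fun ha => Runs.assign ?_) fun ha => Runs.skip ?_
      · rw [ne_eq, hpi, not_not] at ha
        simp only [State.setReg_reg, if_true, Expr.eval_add, Expr.eval_reg, Expr.eval_const,
          card_filter_range_succ, ha, h8₁]
        omega
      · rw [hpi] at ha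
        simp only [card_filter_range_succ, ha, h8₁, if_false, add_zero]
    refine hmid.mono fun s₂ hf₂ h8₂ => ?_
    have hE₂ := hE₁.frame hf₂ ⟨rfl, rfl, rfl, rfl, rfl⟩
    have hx₂ : s₂.reg 2 = i := (hf₂.1 2 rfl).trans hx₁
    have hc₂ : s₂.cfg = s.cfg := (cfg_eq_of_frame hf₂ ⟨rfl, rfl, rfl⟩).trans hc₁
    have h7₂ : s₂.reg 7 = s.reg 7 := (hf₂.1 7 rfl).trans h7₁
    have h9₂ : s₂.reg 9 = G.r * ((range i).filter q).card := (hf₂.1 9 rfl).trans h9₁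
    have hqi : (Expr.and (.get 3 (.reg 2)) (.eq (levelE 2) (.reg 7))).eval s₂ = 0 ↔ ¬ q i := by
      simp only [Expr.eval_and_eq_zero, eval_sel, Expr.eval_eq_eq_zero, eval_levelE hE₂,
        Expr.eval_reg, hc₂, hx₂, h7₂, hq, ne_eq, not_not]
    refine Runs.branch (fun ha => Runs.assign ?_) fun ha => Runs.skip ?_
    · rw [ne_eq, hqi, not_not] at ha
      simp [card_filter_range_succ, ha, h8₂, h9₂, hE₂.r]
      ring
    · rw [hqi] at ha
      simp [card_filter_range_succ, ha, h8₂, h9₂]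
  · rintro s' - - ⟨h8, h9⟩
    rw [h8, h9, hE₀.m]
    simp only [ConflictSystem.freeAt, ConflictSystem.lvl]
    constructor <;> congr!

/-- Cover the vertex of the edge in register `2` by this edge. -/
def swapEdge : Prog :=
  .seq (forLoop 3 0 (.branch (.eq (vertE 3) (vertE 2)) (.store 3 (.reg 3) (.const 0)) .skip))
    (.seq (.store 3 (.reg 2) (.const 1)) (.store 7 (vertE 2) (.const 0)))

theorem runs_swapEdge (hE : Env G s) (hN : G.m ≤ N) :
    Runs N swapEdge s fun s' => s'.cfg = G.swap s.cfg (s.reg 2) := by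
  refine Runs.seq (Runs.forLoop (fun n s' => ∀ f, s'.arr 3 f =
    if f < n ∧ G.vert f = G.vert (s.reg 2) then 0 else s.arr 3 f) (by rwa [hE.m]) rfl rfl
    (by decide) (by simp) ?_ ?_)
  · rintro i s' hi hf hx hs'
    have hE' := hE.frame hf ⟨rfl, rfl, rfl, rfl, rfl⟩
    have hx2 : s'.reg 2 = s.reg 2 := hf.1 2 rfl
    refine Runs.branch (fun ha => Runs.store ?_) fun ha => Runs.skip ?_
    · rw [ne_eq, Expr.eval_eq_eq_zero, eval_vertE hE', eval_vertE hE', hx, hx2, not_not] at ha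
      intro f
      simp only [State.setReg_arr, State.setArr_arr_self, Expr.eval_reg, Expr.eval_const, hx,
        Function.update_apply, hs']
      by_cases hfi : f = i
      · rw [if_pos hfi, if_pos ⟨by omega, by rw [hfi, ha]⟩]
      · rw [if_neg hfi]
        exact if_congr (and_congr_left fun _ => by omega) rfl rfl
    · rw [Expr.eval_eq_eq_zero, eval_vertE hE', eval_vertE hE', hx, hx2] at ha
      intro f
      simp only [State.setReg_arr, hs']
      refine if_congr (and_congr_left fun hv => ?_) rfl rfl
      have : f ≠ i := by rintro rfl; exact ha hv
      omega
  · intro s₁ hf _ hs₁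
    have hE₁ := hE.frame hf ⟨rfl, rfl, rfl, rfl, rfl⟩
    have hx2 : s₁.reg 2 = s.reg 2 := hf.1 2 rfl
    refine Runs.seq (Runs.store (Runs.store ?_))
    have h6 : s₁.arr 6 = s.arr 6 := hf.2 6 rfl
    have h7 : s₁.arr 7 = s.arr 7 := hf.2 7 rfl
    have hv : (vertE 2).eval (s₁.setArr 3 ((Expr.reg 2).eval s₁) ((Expr.const 1).eval s₁)) =
        G.vert (s.reg 2) := by
      rw [← hx2, ← eval_vertE hE₁]
      simp [vertE, State.setArr_arr]
    rw [hE.m] at hs₁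
    rw [hv]
    ext f
    · simp only [State.cfg, ConflictSystem.swap, State.setArr_arr_of_ne _ _ _ (show 3 ≠ 7 by decide),
        State.setArr_arr_self, Expr.eval_reg, Expr.eval_const, Function.update_apply, hs₁, hx2]
    · simp only [State.cfg, ConflictSystem.swap, State.setArr_arr_of_ne _ _ _ (show 6 ≠ 7 by decide),
        State.setArr_arr_of_ne _ _ _ (show 6 ≠ 3 by decide), h6]
    · simp only [State.cfg, ConflictSystem.swap, State.setArr_arr_of_ne _ _ _ (show 7 ≠ 3 by decide),
        State.setArr_arr_self, h7, Expr.eval_const]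

/-- Swap along the free addable edges at the level in register `7`. -/
def swapLevel : Prog :=
  forLoop 2 0 (.branch (.and (.get 6 (.reg 2)) (.eq (levelE 2) (.reg 7)))
    (.seq testBlocked (.branch (.reg 4) .skip swapEdge)) .skip)

theorem runs_swapLevel (hE : Env G s) (hN : G.m ≤ N) {root : ℕ} (hj : 1 ≤ s.reg 7)
    (h : G.Forest s.cfg root (s.reg 7)) :
    Runs N swapLevel s fun s' => G.Swapped s.cfg s'.cfg root (s.reg 7) G.m := by
  refine Runs.forLoop (fun n s' => G.Swapped s.cfg s'.cfg root (s.reg 7) n) (by rwa [hE.m]) rfl rfl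
    (by decide) (.init h) ?_ fun s' _ _ hs' => by rwa [hE.m] at hs'
  rintro i s' hi hf hx hs'
  have hE' := hE.frame hf ⟨rfl, rfl, rfl, rfl, rfl⟩
  have h7 : s'.reg 7 = s.reg 7 := hf.1 7 rfl
  rw [hE.m] at hi
  refine Runs.branch (fun ha => Runs.seq ?_) fun ha => Runs.skip ?_
  · simp only [ne_eq, Expr.eval_and_eq_zero, eval_layer, Expr.eval_eq_eq_zero, eval_levelE hE',
      Expr.eval_reg, hx, h7, not_not] at ha
    refine (runs_testBlocked hE' hN (by omega)).mono fun s₁ hf₁ h₁ => ?_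
    have hE₁ := hE'.frame hf₁ ⟨rfl, rfl, rfl, rfl, rfl⟩
    have hx₁ : s₁.reg 2 = i := (hf₁.1 2 rfl).trans hx
    have hc₁ : s₁.cfg = s'.cfg := cfg_eq_of_frame hf₁ ⟨rfl, rfl, rfl⟩
    rw [hx] at h₁
    refine Runs.branch (fun hb => Runs.skip ?_) fun hb => ?_
    · change G.Swapped s.cfg s₁.cfg _ _ _
      rw [hc₁]
      exact hs'.skip hj hi fun hcon => h₁.1 hb hcon.2.2
    · refine (runs_swapEdge hE₁ hN).mono fun s₂ _ h₂ => ?_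
      change G.Swapped s.cfg s₂.cfg _ _ _
      rw [h₂, hc₁, hx₁]
      refine hs'.step hj hi ha.1 ha.2 ?_
      by_contra hcon
      exact h₁.2 hcon hb
  · simp only [Expr.eval_and_eq_zero, eval_layer, Expr.eval_eq_eq_zero, eval_levelE hE',
      Expr.eval_reg, hx, h7, ne_eq, not_not] at ha
    exact hs'.skip hj hi fun hcon => ha ⟨hcon.1, hcon.2.1⟩

/-- Remove all layers and levels beyond the level in register `7`. -/
def truncate : Prog :=
  forLoop 2 0 (.seq
    (.branch (.lt (.reg 7) (.get 6 (.reg 2))) (.store 6 (.reg 2) (.const 0)) .skip)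
    (.branch (.lt (.reg 7) (levelE 2)) (.store 7 (vertE 2) (.const 0)) .skip))

theorem runs_truncate (hE : Env G s) (hN : G.m ≤ N) :
    Runs N truncate s fun s' => G.Truncated s.cfg s'.cfg (s.reg 7) := by
  -- Levels are indexed by vertices but visited through edges, so a vertex counts as processed once
  -- some edge below `n` contains it; later visits change nothing.
  refine Runs.forLoop (fun n s' =>
    (∀ e, s'.arr 6 e = if e < n ∧ s.reg 7 < s.arr 6 e then 0 else s.arr 6 e) ∧
    ∀ v, s'.arr 7 v = if (∃ e < n, G.vert e = v) ∧ s.reg 7 < s.arr 7 v then 0 else s.arr 7 v)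
    (by rwa [hE.m]) rfl rfl (by decide) (by simp) ?_ ?_
  · rintro i s' hi hf hx ⟨h₁, h₂⟩
    have hE' := hE.frame hf ⟨rfl, rfl, rfl, rfl, rfl⟩
    have h7 : s'.reg 7 = s.reg 7 := hf.1 7 rfl
    have hfst : Runs N (.branch (.lt (.reg 7) (.get 6 (.reg 2))) (.store 6 (.reg 2) (.const 0))
        .skip) s' fun s₁ =>
        ∀ e, s₁.arr 6 e = if e < i + 1 ∧ s.reg 7 < s.arr 6 e then 0 else s.arr 6 e := by
      have hi₁ : s'.arr 6 i = s.arr 6 i := by rw [h₁, if_neg (by omega)]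
      refine Runs.branch (fun ha => Runs.store fun e => ?_) fun ha => Runs.skip fun e => ?_
      · simp only [ne_eq, Expr.eval_lt_eq_zero, Expr.eval_reg, Expr.eval_get, hx, h7, hi₁,
          not_not] at ha
        simp only [State.setArr_arr_self, Expr.eval_reg, Expr.eval_const, hx,
          Function.update_apply, h₁]
        by_cases hei : e = i
        · subst hei
          rw [if_pos rfl, if_pos ⟨by omega, ha⟩]
        · rw [if_neg hei]
          exact if_congr (and_congr_left fun _ => by omega) rfl rfl
      · simp only [Expr.eval_lt_eq_zero, Expr.eval_reg, Expr.eval_get, hx, h7, hi₁] at ha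
        rw [h₁]
        refine if_congr (and_congr_left fun hv => ?_) rfl rfl
        have : e ≠ i := by rintro rfl; exact ha hv
        omega
    refine Runs.seq (hfst.mono fun s₁ hf₁ h₃ => ?_)
    have hE₁ := hE'.frame hf₁ ⟨rfl, rfl, rfl, rfl, rfl⟩
    have hx₁ : s₁.reg 2 = i := (hf₁.1 2 rfl).trans hx
    have h7₁ : s₁.reg 7 = s.reg 7 := (hf₁.1 7 rfl).trans h7
    have ha7 : s₁.arr 7 = s'.arr 7 := hf₁.2 7 rfl
    have hlev : (levelE 2).eval s₁ = s'.arr 7 (G.vert i) := by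
      rw [eval_levelE hE₁, hx₁, ← ha7]
      rfl
    have hsucc : ∀ v, (∃ e < i + 1, G.vert e = v) ↔ (∃ e < i, G.vert e = v) ∨ v = G.vert i := by
      intro v
      constructor
      · rintro ⟨e, he, rfl⟩
        rcases Nat.lt_succ_iff_lt_or_eq.1 he with he | rfl
        · exact .inl ⟨e, he, rfl⟩
        · exact .inr rfl
      · rintro (⟨e, he, rfl⟩ | rfl)
        · exact ⟨e, by omega, rfl⟩
        · exact ⟨i, by omega, rfl⟩
    refine Runs.branch (fun ha => Runs.store ⟨?_, fun v => ?_⟩) fun ha => Runs.skip ⟨h₃, fun v => ?_⟩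
    · simpa only [State.setReg_arr, State.setArr_arr_of_ne _ _ _ (show 6 ≠ 7 by decide)] using h₃
    · simp only [ne_eq, Expr.eval_lt_eq_zero, Expr.eval_reg, hlev, h7₁, not_not] at ha
      simp only [State.setReg_arr, State.setArr_arr_self, eval_vertE hE₁, Expr.eval_const, hx₁,
        Function.update_apply, ha7, hsucc]
      by_cases hv : v = G.vert i
      · subst hv
        rw [if_pos rfl, if_pos]
        refine ⟨.inr rfl, ?_⟩
        rw [h₂] at ha
        split_ifs at ha <;> omega
      · rw [if_neg hv, h₂]
        simp [hv]
    · simp only [Expr.eval_lt_eq_zero, Expr.eval_reg, hlev, h7₁] at ha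
      simp only [State.setReg_arr, ha7, hsucc]
      rw [h₂]
      by_cases hv : v = G.vert i
      · subst hv
        rw [h₂] at ha
        split_ifs at ha ⊢ with h₄ h₅ h₅ <;> first | rfl | tauto
      · simp [hv]
  · rintro s' hf - ⟨h₁, h₂⟩
    rw [hE.m] at h₁ h₂
    refine ⟨hf.2 3 rfl, fun e he => ?_, fun e he => ?_⟩
    · have := h₁ e
      simp only [he, true_and] at this
      exact this
    · have := h₂ (G.vert e)
      simp only [show ∃ f < G.m, G.vert f = G.vert e from ⟨e, he, rfl⟩, true_and] at this
      exact this

/-- Collapse the level in register `7`. -/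
def collapse : Prog := .seq swapLevel (.seq truncate (.assign 6 (.reg 7)))

theorem runs_collapse (hE : Env G s) (hN : G.m ≤ N) {root : ℕ} (hj : 1 ≤ s.reg 7)
    (h : G.Forest s.cfg root (s.reg 7)) :
    Runs N collapse s fun s' => s'.reg 6 = s.reg 7 ∧
      ∃ c, G.Swapped s.cfg c root (s.reg 7) G.m ∧ G.Truncated c s'.cfg (s.reg 7) := by
  refine Runs.seq ((runs_swapLevel hE hN hj h).mono fun s₁ hf₁ h₁ => Runs.seq ?_)
  have hE₁ := hE.frame hf₁ ⟨rfl, rfl, rfl, rfl, rfl⟩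
  have h7₁ : s₁.reg 7 = s.reg 7 := hf₁.1 7 rfl
  refine (runs_truncate hE₁ hN).mono fun s₂ hf₂ h₂ => Runs.assign ?_
  have h7₂ : s₂.reg 7 = s.reg 7 := (hf₂.1 7 rfl).trans h7₁
  rw [h7₁] at h₂
  exact ⟨by simp [h7₂], _, h₁, h₂⟩

/-- Collapse the level in register `7` if it has many free addable edges. -/
def checkLevel : Prog :=
  .seq measureLevel (.seq (.branch (.lt (.reg 9) (.reg 8)) collapse .skip)
    (.assign 7 (.sub (.reg 7) (.const 1))))

/-- Collapse levels from the top down to the bottom. -/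
def cascade : Prog :=
  .seq (.assign 7 (.sub (.reg 6) (.const 1))) (.loop (.reg 7) checkLevel)

/-- One round of the search. -/
def searchRound : Prog := .seq build cascade

/-- The root is covered, and the search is finished. -/
def Done (G : ConflictSystem) (c : Config) (root : ℕ) : Prop :=
  c.level root = 0 ∧ G.IsMatching c ∧ G.Matched c root

/-- The situation in a round that started with a tree with `k₀` levels of sizes `y₀`: level `j` is
the next one to be checked, and the tree has `k` levels. -/
structure Pending (G : ConflictSystem) (root k₀ : ℕ) (y₀ : ℕ → ℕ) (c : Config) (j k : ℕ) :
    Prop where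
  tree : G.Tree c root k
  lt : j < k
  le : k ≤ k₀ + 1
  same : ∀ i, 1 ≤ i → i < k → (G.lvl c i).card = y₀ i
  last : k = k₀ + 1 ∨ 2 ≤ k ∧ 64 * (G.lvl c k).card ≤ 63 * y₀ k
  quiet : ∀ i, j < i → G.Quiet c i

/-- A quiet level leaves the tree as it is. A collapse at level at least 2 makes that level the last
one, smaller than at the start of the round; a collapse at level 1 covers the root. Earlier
collapses of the same round need no record, since a later one discards their levels or last layer.
-/
theorem runs_checkLevel (hE : Env G s) (hN : G.m ≤ N) {root k₀ : ℕ} {y₀ : ℕ → ℕ}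
    (hj : 1 ≤ s.reg 7) (h : Pending G root k₀ y₀ s.cfg (s.reg 7) (s.reg 6)) :
    Runs N checkLevel s fun s' => (∀ v, G.Matched s.cfg v → G.Matched s'.cfg v) ∧
      s'.reg 7 = s.reg 7 - 1 ∧
      (Pending G root k₀ y₀ s'.cfg (s'.reg 7) (s'.reg 6) ∨ s'.reg 7 = 0 ∧ Done G s'.cfg root) := by
  refine Runs.seq ((runs_measureLevel hE hN).mono fun s₁ hf₁ h₁ => Runs.seq ?_)
  have hE₁ := hE.frame hf₁ ⟨rfl, rfl, rfl, rfl, rfl⟩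
  have h6₁ : s₁.reg 6 = s.reg 6 := hf₁.1 6 rfl
  have h7₁ : s₁.reg 7 = s.reg 7 := hf₁.1 7 rfl
  have hc₁ : s₁.cfg = s.cfg := cfg_eq_of_frame hf₁ ⟨rfl, rfl, rfl⟩
  have hq : (Expr.lt (.reg 9) (.reg 8)).eval s₁ = 0 ↔ G.Quiet s.cfg (s.reg 7) := by
    rw [Expr.eval_lt_eq_zero, Expr.eval_reg, Expr.eval_reg, h₁.1, h₁.2, not_lt]
    rfl
  have hfor : G.Forest s.cfg root (s.reg 7) := h.tree.forest.mono h.lt.le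
  refine Runs.branch (fun ha => ?_) fun ha => Runs.skip (Runs.assign ?_)
  · rw [ne_eq, hq] at ha
    refine (runs_collapse hE₁ hN (root := root) (by omega) (by rwa [hc₁, h7₁])).mono
      fun s₂ hf₂ h₂ => Runs.assign ?_
    rw [hc₁, h7₁] at h₂
    obtain ⟨h6₂, c, hsw, htr⟩ := h₂
    have h7₂ : s₂.reg 7 = s.reg 7 := (hf₂.1 7 rfl).trans h7₁
    simp only [State.setReg_reg, if_true, Expr.eval_sub, Expr.eval_reg, Expr.eval_const, h7₂,
      show (6 : ℕ) ≠ 7 by decide, if_false, h6₂]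
    change (∀ v, G.Matched s.cfg v → G.Matched s₂.cfg v) ∧ _ ∧
      (Pending G root k₀ y₀ s₂.cfg _ _ ∨ _ ∧ Done G s₂.cfg root)
    refine ⟨fun v hv => (htr.matched_iff v).2 (hsw.matched v hv), trivial, ?_⟩
    have hF := htr.forest hsw.forest
    by_cases hj2 : 2 ≤ s.reg 7
    · left
      have hsame : ∀ i, 1 ≤ i → i < s.reg 7 → (G.lvl s₂.cfg i).card = y₀ i := by
        intro i hi hij
        rw [htr.lvl_eq hi hij.le, hsw.lvl_eq i hi hij, h.same i hi (hij.trans h.lt)]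
      refine ⟨⟨hF, htr.rootOpen hsw.forest hj (hsw.rootOpen hj2 h.tree.rootOpen), htr.trimmed⟩,
        by omega, h.lt.le.trans h.le, hsame, .inr ⟨hj2, ?_⟩, fun i hi => ?_⟩
      · rw [htr.lvl_eq hj le_rfl, ← h.same _ hj h.lt]
        exact hsw.shrink h.tree.forest hj2 h.tree.rootOpen ha
      -- The truncated tree has no addable edges at its last level or beyond, so only lower levels
      -- remain to be checked.
      · exact hF.quiet_of_le htr.trimmed (by omega)
    · right
      have hj1 : s.reg 7 = 1 := by omega
      rw [hj1] at hsw htr ha ⊢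
      obtain ⟨hl, hm⟩ := hsw.root_matched h.tree.forest ha
      obtain ⟨e, he, rfl⟩ := hF.root_mem
      exact ⟨rfl, by rw [htr.level_eq_of_le he (by omega), hl], hF.matching,
        (htr.matched_iff _).2 hm⟩
  · rw [hq] at ha
    simp only [State.setReg_reg, if_true, Expr.eval_sub, Expr.eval_reg, Expr.eval_const, h7₁,
      show (6 : ℕ) ≠ 7 by decide, if_false, h6₁]
    change (∀ v, G.Matched s.cfg v → G.Matched s₁.cfg v) ∧ _ ∧
      (Pending G root k₀ y₀ s₁.cfg _ _ ∨ _ ∧ Done G s₁.cfg root)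
    rw [hc₁]
    refine ⟨fun _ h => h, trivial, .inl ⟨h.tree, by have := h.lt; omega, h.le, h.same, h.last,
      fun i hi => ?_⟩⟩
    rcases Nat.lt_or_ge (s.reg 7) i with hi' | hi'
    · exact h.quiet i hi'
    · rwa [show i = s.reg 7 by omega]

theorem runs_searchRound (hE : Env G s) (hN : G.m ≤ N) {root : ℕ} (hk : 1 ≤ s.reg 6)
    (hkN : s.reg 6 ≤ N) (h : G.Tree s.cfg root (s.reg 6)) :
    Runs N searchRound s fun s' => (∀ v, G.Matched s.cfg v → G.Matched s'.cfg v) ∧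
      (Pending G root (s.reg 6) (fun i => (G.lvl s.cfg i).card) s'.cfg 0 (s'.reg 6) ∨
        Done G s'.cfg root) := by
  refine Runs.seq ((runs_build hE hN h.forest h.rootOpen h.trimmed hk).mono fun s₁ hf₁ h₁ => ?_)
  obtain ⟨h6₁, hF, hR, hT, hlvl, hmat⟩ := h₁
  have hE₁ := hE.frame hf₁ ⟨rfl, rfl, rfl, rfl, rfl⟩
  refine Runs.seq (Runs.assign ?_)
  refine Runs.loop (fun s' => Env G s' ∧ (∀ v, G.Matched s.cfg v → G.Matched s'.cfg v) ∧
    (Pending G root (s.reg 6) (fun i => (G.lvl s.cfg i).card) s'.cfg (s'.reg 7) (s'.reg 6) ∨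
      s'.reg 7 = 0 ∧ Done G s'.cfg root)) (fun s' => s'.reg 7) ?_ ?_ ?_ ?_
  · refine ⟨hE₁.setReg (by decide) (by decide), fun v hv => (hmat v).2 hv, .inl ?_⟩
    simp only [State.setReg_reg, if_true, Expr.eval_sub, Expr.eval_reg, Expr.eval_const,
      show (6 : ℕ) ≠ 7 by decide, if_false, h6₁]
    change Pending G root (s.reg 6) (fun i => (G.lvl s.cfg i).card) s₁.cfg _ _
    exact ⟨⟨hF, hR, hT⟩, by omega, le_rfl, fun i hi hik => by rw [hlvl i hi hik], .inl rfl,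
      fun i hi => hF.quiet_of_le hT (by omega)⟩
  · simp [h6₁, hkN]
  · rintro s' - ⟨hE', hm', h'⟩ hne
    rw [Expr.eval_reg] at hne
    have hP := h'.resolve_right fun h => hne h.1
    refine (runs_checkLevel hE' hN (by omega) hP).mono fun s'' hf'' h'' => ?_
    exact ⟨⟨hE'.frame hf'' ⟨rfl, rfl, rfl, rfl, rfl⟩, fun v hv => h''.1 v (hm' v hv), h''.2.2⟩,
      by omega⟩
  · rintro s' - ⟨-, hm', h'⟩ h0
    rw [Expr.eval_reg] at h0
    rw [h0] at h'
    exact ⟨hm', h'.imp_right fun h => h.2⟩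

/-- Search until the vertex in register `10` is covered. -/
def search : Prog := .loop (.get 7 (.reg 10)) searchRound

theorem runs_search (hE : Env G s) (hN : (G.m + 2) * G.m ^ 45 + 1 ≤ N) (h6 : s.reg 6 = 1)
    (h : G.Tree s.cfg (s.reg 10) 1) :
    Runs N search s fun s' => (∀ v, G.Matched s.cfg v → G.Matched s'.cfg v) ∧
      Done G s'.cfg (s.reg 10) := by
  obtain ⟨e₀, he₀, -⟩ := h.forest.root_mem
  have hpow : 1 ≤ G.m ^ 45 := Nat.one_le_pow _ _ (by omega)
  have hmN : G.m + 2 ≤ N := by nlinarith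
  refine Runs.loop (fun s' => Env G s' ∧ s'.reg 10 = s.reg 10 ∧
      (∀ v, G.Matched s.cfg v → G.Matched s'.cfg v) ∧
      (G.Tree s'.cfg (s.reg 10) (s'.reg 6) ∧ 1 ≤ s'.reg 6 ∧ (∀ i, 1 ≤ i → G.Quiet s'.cfg i) ∨
        Done G s'.cfg (s.reg 10)))
    -- Level 0 of the root signals success. The summand 1 otherwise makes the finishing round
    -- decrease the variant too.
    (fun s' => if s'.cfg.level (s.reg 10) = 0 then 0 else
      ConflictSystem.roundsLeft G.m (s'.reg 6) (fun i => (G.lvl s'.cfg i).card) + 1) ?_ ?_ ?_ ?_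
  · rw [h6]
    exact ⟨hE, rfl, fun _ h => h, .inl ⟨h, le_rfl, fun i hi =>
      h.forest.quiet_of_le h.trimmed hi⟩⟩
  · have := ConflictSystem.roundsLeft_le G.m (s.reg 6) (fun i => (G.lvl s.cfg i).card)
    split_ifs <;> omega
  · rintro s' - ⟨hE', h10, hm', h'⟩ hne
    rw [Expr.eval_get, Expr.eval_reg, h10] at hne
    change s'.cfg.level _ ≠ 0 at hne
    obtain ⟨hT, hk, hq⟩ := h'.resolve_right fun h => hne h.1
    have hv := hT.validSizes hk hq
    -- The inner loop over the levels also has to respect `N`; the logarithmic depth is more than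
    -- enough.
    have hkm : s'.reg 6 ≤ N := by
      have h₁ := hv.two_pow_le
      have h₂ : s'.reg 6 < 2 ^ s'.reg 6 := Nat.lt_two_pow_self
      omega
    refine (runs_searchRound hE' (by omega) hk hkm hT).mono fun s'' hf'' h'' => ?_
    obtain ⟨hm'', h''⟩ := h''
    refine ⟨⟨hE'.frame hf'' ⟨rfl, rfl, rfl, rfl, rfl⟩, (hf''.1 10 rfl).trans h10,
      fun v hv => hm'' v (hm' v hv), ?_⟩, ?_⟩
    · exact h''.imp_left fun h'' => ⟨h''.tree, h''.lt, fun i hi => h''.quiet i hi⟩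
    · rw [if_neg hne]
      split_ifs with h0
      · exact Nat.succ_pos _
      · have hP := h''.resolve_right fun h => h0 h.1
        have hv' := hP.tree.validSizes hP.lt fun i hi => hP.quiet i hi
        exact Nat.add_lt_add_right (hv.roundsLeft_lt hv' (by omega) hP.le hP.same hP.last) 1
  · rintro s' - ⟨-, h10, hm', h'⟩ h0
    rw [Expr.eval_get, Expr.eval_reg, h10] at h0
    refine ⟨hm', h'.resolve_left fun h => ?_⟩
    have := h.1.rootOpen.1
    change s'.arr 7 _ = 1 at this
    omega

/-! ### Covering all vertices -/

/-- Initialize a tree whose root is the vertex in register `10`. -/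
def initTree : Prog :=
  .seq (forLoop 2 0 (.seq (.store 6 (.reg 2) (.const 0)) (.store 7 (vertE 2) (.const 0))))
    (.seq (.store 7 (.reg 10) (.const 1)) (.assign 6 (.const 1)))

theorem runs_initTree (hE : Env G s) (hN : G.m ≤ N) :
    Runs N initTree s fun s' => s'.reg 6 = 1 ∧ (∀ e < G.m, s'.cfg.layer e = 0) ∧
      ∀ e < G.m, s'.cfg.level (G.vert e) = if G.vert e = s.reg 10 then 1 else 0 := by
  refine Runs.seq (Runs.forLoop (fun n s' => (∀ e < n, s'.arr 6 e = 0) ∧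
    ∀ e < n, s'.arr 7 (G.vert e) = 0) (by rwa [hE.m]) rfl rfl (by decide) (by simp) ?_ ?_)
  · rintro i s' hi hf hx ⟨h₁, h₂⟩
    have hE' := hE.frame hf ⟨rfl, rfl, rfl, rfl, rfl⟩
    refine Runs.seq (Runs.store (Runs.store ?_))
    have hv : (vertE 2).eval (s'.setArr 6 ((Expr.reg 2).eval s') ((Expr.const 0).eval s')) =
        G.vert i := by
      rw [← hx, ← eval_vertE hE']
      simp [vertE, State.setArr_arr]
    rw [hv]
    constructor
    · intro e he
      simp only [State.setReg_arr, State.setArr_arr_of_ne _ _ _ (show 6 ≠ 7 by decide),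
        State.setArr_arr_self, Function.update_apply, Expr.eval_reg, Expr.eval_const, hx]
      split_ifs with h
      · rfl
      · exact h₁ e (by omega)
    · intro e he
      simp only [State.setReg_arr, State.setArr_arr_self,
        State.setArr_arr_of_ne _ _ _ (show 7 ≠ 6 by decide),
        Function.update_apply, Expr.eval_const]
      split_ifs with h
      · rfl
      · exact h₂ e (lt_of_le_of_ne (by omega) (by rintro rfl; exact h rfl))
  · rintro s' hf - ⟨h₁, h₂⟩
    rw [hE.m] at h₁ h₂
    have h10 : s'.reg 10 = s.reg 10 := hf.1 10 rfl
    refine Runs.seq (Runs.store (Runs.assign ⟨by simp, fun e he => ?_, fun e he => ?_⟩))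
    · simp only [State.cfg, State.setReg_arr]
      rw [State.setArr_arr_of_ne _ _ _ (by decide)]
      exact h₁ e he
    · simp only [State.cfg, State.setReg_arr, State.setArr_arr_self, Function.update_apply, Expr.eval_reg, Expr.eval_const, h10]
      split_ifs
      · rfl
      · exact h₂ e he

/-- Test whether the vertex in register `10` is covered. -/
def testMatched : Prog := anyLoop 3 4 (.and (.get 3 (.reg 3)) (.eq (vertE 3) (.reg 10)))

theorem runs_testMatched (hE : Env G s) (hN : G.m ≤ N) :
    Runs N testMatched s fun s' => s'.reg 4 ≠ 0 ↔ G.Matched s.cfg (s.reg 10) := by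
  refine Runs.anyLoop (fun f => s.cfg.sel f ≠ 0 ∧ G.vert f = s.reg 10)
    (by rwa [hE.m]) (by decide) (by decide) (by decide) ?_ ?_
  · rintro i s' hi hf rfl
    have hE' := hE.frame hf ⟨rfl, rfl, rfl, rfl, rfl⟩
    have h10 : s'.reg 10 = s.reg 10 := hf.1 10 rfl
    have hc : s'.cfg = s.cfg := cfg_eq_of_frame hf ⟨rfl, rfl, rfl⟩
    simp [eval_sel, eval_vertE hE', h10, hc, -Expr.eval_get]
  · intro s' hf h
    rw [h, hE.m]
    rfl

/-- Cover the vertex in register `10`. -/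
def coverVertex : Prog :=
  .seq testMatched (.branch (.reg 4) .skip (.seq initTree search))

theorem runs_coverVertex (hE : Env G s) (hN : (G.m + 2) * G.m ^ 45 + 1 ≤ N)
    (hr : ∃ e < G.m, G.vert e = s.reg 10) (hm : G.IsMatching s.cfg) :
    Runs N coverVertex s fun s' => G.IsMatching s'.cfg ∧
      (∀ v, G.Matched s.cfg v → G.Matched s'.cfg v) ∧ G.Matched s'.cfg (s.reg 10) := by
  obtain ⟨e₀, he₀, -⟩ := id hr
  have hpow : 1 ≤ G.m ^ 45 := Nat.one_le_pow _ _ (by omega)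
  have hmN : G.m ≤ N := by nlinarith
  refine Runs.seq ((runs_testMatched hE hmN).mono fun s₁ hf₁ h₁ => ?_)
  have hE₁ := hE.frame hf₁ ⟨rfl, rfl, rfl, rfl, rfl⟩
  have h10₁ : s₁.reg 10 = s.reg 10 := hf₁.1 10 rfl
  have hc₁ : s₁.cfg = s.cfg := cfg_eq_of_frame hf₁ ⟨rfl, rfl, rfl⟩
  refine Runs.branch (fun ha => Runs.skip ?_) fun ha => Runs.seq ?_
  · rw [hc₁]
    exact ⟨hm, fun _ h => h, h₁.1 ha⟩
  · have hnm : ¬ G.Matched s.cfg (s.reg 10) := fun h => h₁.2 h ha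
    refine (runs_initTree hE₁ hmN).mono fun s₂ hf₂ h₂ => ?_
    have hE₂ := hE₁.frame hf₂ ⟨rfl, rfl, rfl, rfl, rfl⟩
    have h10₂ : s₂.reg 10 = s.reg 10 := (hf₂.1 10 rfl).trans h10₁
    have hsel : s₂.cfg.sel = s.cfg.sel := (hf₂.2 3 rfl).trans (hf₁.2 3 rfl)
    have hmat : ∀ v, G.Matched s₂.cfg v ↔ G.Matched s.cfg v := by
      simp only [ConflictSystem.Matched, hsel, implies_true]
    obtain ⟨h6, hlay, hlev⟩ := h₂
    rw [h10₁] at hlev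
    have hinit := ConflictSystem.Forest.init (c := s₂.cfg) (root := s.reg 10)
      (by rw [ConflictSystem.IsMatching, hsel]; exact hm) hlay hr hlev
    have hT : G.Tree s₂.cfg (s.reg 10) 1 := by
      refine ⟨hinit.1, ⟨?_, by rwa [hmat]⟩, hinit.2⟩
      obtain ⟨e, he, h⟩ := hr
      rw [← h, hlev e he, if_pos h]
    refine (runs_search hE₂ hN h6 (by rwa [h10₂])).mono fun s₃ _ h₃ => ?_
    rw [h10₂] at h₃
    exact ⟨h₃.2.2.1, fun v hv => h₃.1 v ((hmat v).2 hv), h₃.2.2.2⟩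

/-- Cover the vertices one after the other. -/
def coverAll : Prog := forLoop 11 0 (.seq (.assign 10 (vertE 11)) coverVertex)

/-- Running over edges instead of vertices may treat a vertex repeatedly, which is harmless since
covered vertices are skipped. Earlier successes persist because the search keeps covered vertices
covered. -/
theorem runs_coverAll (hE : Env G s) (hN : (G.m + 2) * G.m ^ 45 + 1 ≤ N) (hmN : G.m ≤ N)
    (hm : G.IsMatching s.cfg) :
    Runs N coverAll s fun s' => G.IsMatching s'.cfg ∧ ∀ e < G.m, G.Matched s'.cfg (G.vert e) := by
  refine Runs.forLoop (fun n s' => G.IsMatching s'.cfg ∧ ∀ e < n, G.Matched s'.cfg (G.vert e))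
    (by rwa [hE.m]) rfl rfl (by decide) ⟨hm, fun e he => absurd he (Nat.not_lt_zero e)⟩ ?_
    fun s' _ _ hs' => by rwa [hE.m] at hs'
  rintro i s' hi hf hx ⟨h₁, h₂⟩
  have hE' := hE.frame hf ⟨rfl, rfl, rfl, rfl, rfl⟩
  rw [hE.m] at hi
  refine Runs.seq (Runs.assign ?_)
  rw [eval_vertE hE', hx]
  refine (runs_coverVertex (hE'.setReg (by decide) (by decide)) hN ⟨i, hi, by simp⟩ h₁).mono
    fun s₁ _ h₃ => ?_
  simp only [State.setReg_reg, if_true] at h₃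
  refine ⟨h₃.1, fun e he => ?_⟩
  rcases Nat.lt_succ_iff_lt_or_eq.1 he with he | rfl
  · exact h₃.2.1 _ (h₂ e he)
  · exact h₃.2.2

end RAM

/-! ### Preprocessing: offsets, maximal edge size and conflict matrix -/

namespace RAM

open Classical

/-- The listed edge number `e`. -/
def edgeAt (L : List (ℕ × List ℕ)) (e : ℕ) : ℕ × List ℕ := L.getD e (0, [])

/-- The number of `B`-vertices of edge number `e`. -/
def edgeLen (L : List (ℕ × List ℕ)) (e : ℕ) : ℕ := (edgeAt L e).2.length

/-- The maximal number of `B`-vertices of an edge. -/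
def maxLen (L : List (ℕ × List ℕ)) : ℕ := (range L.length).sup (edgeLen L)

/-- The edges with numbers `e` and `f` have a common `B`-vertex. -/
def EdgesMeet (L : List (ℕ × List ℕ)) (e f : ℕ) : Prop :=
  ∃ b, b ∈ (edgeAt L e).2 ∧ b ∈ (edgeAt L f).2

theorem edgeAt_eq_getElem {L : List (ℕ × List ℕ)} {e : ℕ} (h : e < L.length) :
    edgeAt L e = L[e] := by
  simp [edgeAt, h]

theorem edgeAt_mem {L : List (ℕ × List ℕ)} {e : ℕ} (h : e < L.length) : edgeAt L e ∈ L := by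
  rw [edgeAt_eq_getElem h]
  exact List.getElem_mem h

theorem input_arr_zero (L : List (ℕ × List ℕ)) : (input L).arr 0 = fun e => (edgeAt L e).1 := by
  funext e
  exact List.getD_map (n := e) L (0, []) Prod.fst

theorem input_arr_one (L : List (ℕ × List ℕ)) : (input L).arr 1 = edgeLen L := by
  funext e
  exact List.getD_map (n := e) L (0, []) fun x => x.2.length

theorem flatMap_getD (L : List (ℕ × List ℕ)) {e u : ℕ} (he : e < L.length)
    (hu : u < edgeLen L e) :
    (L.flatMap Prod.snd).getD (∑ f ∈ range e, edgeLen L f + u) 0 = (edgeAt L e).2.getD u 0 := by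
  induction L generalizing e with
  | nil => exact absurd he (Nat.not_lt_zero e)
  | cons x L ih =>
    cases e with
    | zero =>
      have hu' : u < x.2.length := hu
      simp [edgeAt, List.getElem?_append, hu']
    | succ e =>
      have h₁ : ∑ f ∈ range (e + 1), edgeLen (x :: L) f =
          ∑ f ∈ range e, edgeLen L f + x.2.length := sum_range_succ' _ _
      have h₂ := ih (e := e) (by simpa using he) hu
      rw [h₁, show edgeAt (x :: L) (e + 1) = edgeAt L e from rfl, ← h₂]
      simp only [List.flatMap_cons, List.getD_eq_getElem?_getD]
      rw [List.getElem?_append_right (by omega)]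
      congr 2
      omega

variable {N : ℕ} {s : State} {L : List (ℕ × List ℕ)}

/-- Compute the offsets of the edges in array `2`, the offsets of the rows of the conflict matrix,
and the maximal number of `B`-vertices. -/
def prepareOffsets : Prog :=
  .seq (.assign 1 (.const 0)) (.seq (.assign 12 (.const 0)) (.seq (.assign 13 (.const 0))
    (forLoop 2 0
      (.seq (.store 8 (.reg 2) (.reg 12)) (.seq (.store 5 (.reg 2) (.reg 13))
        (.seq (.assign 12 (.add (.reg 12) (.get 1 (.reg 2))))
          (.seq (.assign 13 (.add (.reg 13) (.reg 0)))
            (.branch (.lt (.reg 1) (.get 1 (.reg 2))) (.assign 1 (.get 1 (.reg 2))) .skip))))))))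

theorem runs_prepareOffsets (h0 : s.reg 0 = L.length) (h1 : s.arr 1 = edgeLen L)
    (hN : L.length ≤ N) :
    Runs N prepareOffsets s fun s' => s'.reg 1 = maxLen L ∧
      ∀ e < L.length, s'.arr 8 e = ∑ f ∈ range e, edgeLen L f ∧ s'.arr 5 e = e * L.length := by
  refine Runs.seq (Runs.assign (Runs.seq (Runs.assign (Runs.seq (Runs.assign ?_)))))
  -- The row offsets `e * L.length` arise by repeated addition. The bound on edge sizes is not part
  -- of the input and is replaced by the actual maximum.
  refine Runs.forLoop (fun n s' => s'.reg 1 = (range n).sup (edgeLen L) ∧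
    s'.reg 12 = ∑ f ∈ range n, edgeLen L f ∧ s'.reg 13 = n * L.length ∧
    ∀ e < n, s'.arr 8 e = ∑ f ∈ range e, edgeLen L f ∧ s'.arr 5 e = e * L.length)
    (by simpa [h0] using hN) rfl rfl (by decide) (by simp) ?_ ?_
  · rintro i s' hi hf hx ⟨hr, h12, h13, harr⟩
    have h0' : s'.reg 0 = L.length := (hf.1 0 rfl).trans (by simp [h0])
    have h1' : s'.arr 1 = edgeLen L := (hf.2 1 rfl).trans h1
    refine Runs.seq (Runs.store (Runs.seq (Runs.store (Runs.seq (Runs.assign (Runs.seq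
      (Runs.assign ?_)))))))
    have hfin : ∀ e ≤ i, Function.update (s'.arr 8) i (∑ f ∈ range i, edgeLen L f) e =
        ∑ f ∈ range e, edgeLen L f ∧ Function.update (s'.arr 5) i (i * L.length) e =
        e * L.length := by
      intro e he
      by_cases hei : e = i
      · subst hei
        simp
      · simpa [hei] using harr e (by omega)
    have hs := Finset.sum_range_succ (edgeLen L) i
    have hsup : (range (i + 1)).sup (edgeLen L) = max ((range i).sup (edgeLen L)) (edgeLen L i) := by
      rw [range_add_one, sup_insert, max_comm]
    refine Runs.branch (fun ha => Runs.assign ?_) fun ha => Runs.skip ?_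
    · have ha' : (range i).sup (edgeLen L) < edgeLen L i := by
        simpa [State.setArr_arr, hx, h1', hr, -Finset.sup_lt_iff] using ha
      simp [State.setArr_arr, hx, h1', h0', h12, h13, hs, hsup, Nat.succ_mul,
        -Finset.sup_le_iff]
      exact ⟨ha'.le, hfin⟩
    · have ha' : edgeLen L i ≤ (range i).sup (edgeLen L) := by
        simpa [State.setArr_arr, hx, h1', hr] using ha
      simp [State.setArr_arr, hx, h1', h0', hr, h12, h13, hs, hsup, Nat.succ_mul]
      exact ⟨ha', hfin⟩
  · rintro s' - - ⟨hr, -, -, harr⟩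
    have : ((((s.setReg 1 ((Expr.const 0).eval s)).setReg 12 0).setReg 13 0).reg 0) = L.length := by
      simp [h0]
    exact ⟨by rw [hr]; simp [h0, maxLen], fun e he => harr e (by simpa [h0] using he)⟩

/-- Array `4` of `s'` is that of `s`, except that cell `c` is marked if `p` holds. -/
def MarkIf (s s' : State) (c : ℕ) (p : Prop) : Prop :=
  (∀ i, i ≠ c → s'.arr 4 i = s.arr 4 i) ∧ (s'.arr 4 c ≠ 0 ↔ s.arr 4 c ≠ 0 ∨ p)

theorem MarkIf.trans {s s₁ s₂ : State} {c : ℕ} {p q : Prop} (h₁ : MarkIf s s₁ c p)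
    (h₂ : MarkIf s₁ s₂ c q) : MarkIf s s₂ c (p ∨ q) :=
  ⟨fun i hi => (h₂.1 i hi).trans (h₁.1 i hi), by rw [h₂.2, h₁.2, or_assoc]⟩

theorem MarkIf.congr {s s' : State} {c : ℕ} {p q : Prop} (h : MarkIf s s' c p) (hpq : p ↔ q) :
    MarkIf s s' c q := ⟨h.1, by rw [h.2, hpq]⟩

theorem exists_lt_succ_iff (p : ℕ → Prop) (n : ℕ) :
    (∃ i < n + 1, p i) ↔ (∃ i < n, p i) ∨ p n := by
  constructor
  · rintro ⟨i, hi, h⟩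
    rcases Nat.lt_succ_iff_lt_or_eq.1 hi with hi | rfl
    · exact .inl ⟨i, hi, h⟩
    · exact .inr h
  · rintro (⟨i, hi, h⟩ | h)
    · exact ⟨i, by omega, h⟩
    · exact ⟨n, by omega, h⟩

/-- The memory holds the edges together with their offsets. -/
structure Prepared (L : List (ℕ × List ℕ)) (s : State) : Prop where
  m : s.reg 0 = L.length
  len : s.arr 1 = edgeLen L
  mem : ∀ e < L.length, ∀ u < edgeLen L e, s.arr 2 (s.arr 8 e + u) = (edgeAt L e).2.getD u 0
  base : ∀ e < L.length, s.arr 5 e = e * L.length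

theorem Prepared.frame {P : Prog} {s s' : State} (h : Prepared L s) (hf : Frame P s s')
    (hP : P.setsReg 0 = false ∧ P.setsArr 1 = false ∧ P.setsArr 2 = false ∧
      P.setsArr 5 = false ∧ P.setsArr 8 = false) : Prepared L s' := by
  obtain ⟨h₁, h₂, h₃, h₄, h₅⟩ := hP
  refine ⟨(hf.1 0 h₁).trans h.m, (hf.2 1 h₂).trans h.len, ?_, ?_⟩
  · rw [hf.2 2 h₃, hf.2 8 h₅]
    exact h.mem
  · rw [hf.2 5 h₄]
    exact h.base

/-- Mark a conflict between the edges in registers `2` and `3` if the `B`-vertices with the numbers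
in registers `16` and `17` agree. -/
def compareVertices : Prog :=
  .branch (.eq (.get 2 (.add (.get 8 (.reg 2)) (.reg 16)))
      (.get 2 (.add (.get 8 (.reg 3)) (.reg 17))))
    (.store 4 (.add (.get 5 (.reg 2)) (.reg 3)) (.const 1)) .skip

/-- Mark a conflict between the edges in registers `2` and `3` if they meet. -/
def compareEdges : Prog :=
  .seq (.assign 14 (.get 1 (.reg 2))) (.seq (.assign 15 (.get 1 (.reg 3)))
    (forLoop 16 14 (forLoop 17 15 compareVertices)))

theorem runs_compareVertices (h : Prepared L s) {e f u v : ℕ} (he : e < L.length)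
    (hf : f < L.length) (hu : u < edgeLen L e) (hv : v < edgeLen L f) (h2 : s.reg 2 = e)
    (h3 : s.reg 3 = f) (h16 : s.reg 16 = u) (h17 : s.reg 17 = v) :
    Runs N compareVertices s fun s' => MarkIf s s' (e * L.length + f)
      ((edgeAt L e).2.getD u 0 = (edgeAt L f).2.getD v 0) := by
  have hev : (Expr.eq (.get 2 (.add (.get 8 (.reg 2)) (.reg 16)))
      (.get 2 (.add (.get 8 (.reg 3)) (.reg 17)))).eval s = 0 ↔
      ¬ (edgeAt L e).2.getD u 0 = (edgeAt L f).2.getD v 0 := by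
    rw [Expr.eval_eq_eq_zero]
    simp only [Expr.eval_get, Expr.eval_add, Expr.eval_reg, h2, h3, h16, h17]
    rw [h.mem e he u hu, h.mem f hf v hv]
  refine Runs.branch (fun ha => Runs.store ?_) fun ha => Runs.skip ?_
  · rw [ne_eq, hev, not_not] at ha
    have hc : (Expr.add (.get 5 (.reg 2)) (.reg 3)).eval s = e * L.length + f := by
      simp [h2, h3, h.base e he]
    rw [hc]
    exact ⟨fun i hi => by simp [hi], by simp [-List.getD_eq_getElem?_getD, ha]⟩
  · rw [hev] at ha
    exact ⟨fun _ _ => rfl, by simp only [ha, or_false]⟩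

theorem runs_compareEdges (h : Prepared L s) {e f : ℕ} (he : e < L.length)
    (hf : f < L.length) (h2 : s.reg 2 = e) (h3 : s.reg 3 = f)
    (hN : ∀ e < L.length, edgeLen L e ≤ N) :
    Runs N compareEdges s fun s' => MarkIf s s' (e * L.length + f) (EdgesMeet L e f) := by
  refine Runs.seq (Runs.assign (Runs.seq (Runs.assign ?_)))
  set s₀ := (s.setReg 14 ((Expr.get 1 (.reg 2)).eval s)).setReg 15
    ((Expr.get 1 (.reg 3)).eval (s.setReg 14 ((Expr.get 1 (.reg 2)).eval s))) with hs₀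
  have hP₀ : Prepared L s₀ := ⟨by simp [hs₀, h.m], h.len, h.mem, h.base⟩
  have h14 : s₀.reg 14 = edgeLen L e := by simp [hs₀, h2, h.len]
  have h15 : s₀.reg 15 = edgeLen L f := by simp [hs₀, h3, h.len]
  set q : ℕ → ℕ → Prop := fun u v => (edgeAt L e).2.getD u 0 = (edgeAt L f).2.getD v 0 with hq
  refine Runs.forLoop (fun n s' => MarkIf s s' (e * L.length + f)
    (∃ u < n, ∃ v < edgeLen L f, q u v)) (by rw [h14]; exact hN e he) rfl rfl (by decide)
    ⟨fun _ _ => rfl, by simp [hs₀]⟩ ?_ ?_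
  · rintro u s₁ hu hf₁ hx₁ hm₁
    rw [h14] at hu
    have hP₁ := hP₀.frame hf₁ ⟨rfl, rfl, rfl, rfl, rfl⟩
    have h15₁ : s₁.reg 15 = edgeLen L f := (hf₁.1 15 rfl).trans h15
    have h2₁ : s₁.reg 2 = e := (hf₁.1 2 rfl).trans (by simp [hs₀, h2])
    have h3₁ : s₁.reg 3 = f := (hf₁.1 3 rfl).trans (by simp [hs₀, h3])
    refine Runs.forLoop (fun n s' => MarkIf s₁ s' (e * L.length + f) (∃ v < n, q u v))
      (by rw [h15₁]; exact hN f hf) rfl rfl (by decide) ⟨fun _ _ => rfl, by simp⟩ ?_ ?_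
    · rintro v s₂ hv hf₂ hx₂ hm₂
      rw [h15₁] at hv
      refine (runs_compareVertices (hP₁.frame hf₂ ⟨rfl, rfl, rfl, rfl, rfl⟩) he hf hu hv
        ((hf₂.1 2 rfl).trans h2₁) ((hf₂.1 3 rfl).trans h3₁) ((hf₂.1 16 rfl).trans hx₁) hx₂).mono
        fun s₃ _ hm₃ => ?_
      exact (hm₂.trans hm₃).congr (exists_lt_succ_iff (q u) v).symm
    · intro s₂ _ _ hm₂
      rw [h15₁] at hm₂
      exact (hm₁.trans hm₂).congr
        (exists_lt_succ_iff (fun u => ∃ v < edgeLen L f, q u v) u).symm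
  · intro s' _ _ hm
    rw [h14] at hm
    refine hm.congr ⟨?_, ?_⟩
    · rintro ⟨u, hu, v, hv, huv⟩
      have hu' : u < (edgeAt L e).2.length := hu
      have hv' : v < (edgeAt L f).2.length := hv
      simp only [hq, List.getD_eq_getElem _ _ hu', List.getD_eq_getElem _ _ hv'] at huv
      exact ⟨_, List.getElem_mem hu', huv ▸ List.getElem_mem hv'⟩
    · rintro ⟨b, hb, hb'⟩
      obtain ⟨u, hu, rfl⟩ := List.mem_iff_getElem.1 hb
      obtain ⟨v, hv, huv⟩ := List.mem_iff_getElem.1 hb'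
      refine ⟨u, hu, v, hv, ?_⟩
      simp only [hq, List.getD_eq_getElem _ _ hu, List.getD_eq_getElem _ _ hv, huv]

/-- Compute the conflict matrix. -/
def prepareConflicts : Prog := forLoop 2 0 (forLoop 3 0 compareEdges)

/-- Different pairs of edges have different cells in the flattened matrix, so a mark affects one
pair only. -/
theorem mul_add_inj {m e f e' f' : ℕ} (hf : f < m) (hf' : f' < m) :
    e * m + f = e' * m + f' ↔ e = e' ∧ f = f' := by
  refine ⟨fun h => ?_, fun h => by rw [h.1, h.2]⟩
  have he : e = e' := by
    rcases lt_trichotomy e e' with h' | h' | h'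
    · nlinarith
    · exact h'
    · nlinarith
  subst he
  exact ⟨rfl, by omega⟩

theorem runs_prepareConflicts (h : Prepared L s) (h4 : ∀ i, s.arr 4 i = 0) (hmN : L.length ≤ N)
    (hN : ∀ e < L.length, edgeLen L e ≤ N) :
    Runs N prepareConflicts s fun s' => ∀ e < L.length, ∀ f < L.length,
      s'.arr 4 (e * L.length + f) ≠ 0 ↔ EdgesMeet L e f := by
  refine Runs.forLoop (fun n s' => ∀ e < L.length, ∀ f < L.length,
    s'.arr 4 (e * L.length + f) ≠ 0 ↔ EdgesMeet L e f ∧ e < n) (by rwa [h.m]) rfl rfl (by decide)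
    (by simp [h4]) ?_ ?_
  · rintro e s₁ he hf₁ hx₁ h₁
    rw [h.m] at he
    have hP₁ := h.frame hf₁ ⟨rfl, rfl, rfl, rfl, rfl⟩
    -- The pairs treated so far are those before `(e, n)` in the lexicographic order.
    refine Runs.forLoop (fun n s' => ∀ e' < L.length, ∀ f' < L.length,
      s'.arr 4 (e' * L.length + f') ≠ 0 ↔ EdgesMeet L e' f' ∧ (e' < e ∨ e' = e ∧ f' < n))
      (by rwa [hP₁.m]) rfl rfl (by decide) (by simpa using h₁) ?_ ?_
    · rintro f s₂ hf hf₂ hx₂ h₂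
      rw [hP₁.m] at hf
      refine (runs_compareEdges (hP₁.frame hf₂ ⟨rfl, rfl, rfl, rfl, rfl⟩) he hf
        ((hf₂.1 2 rfl).trans hx₁) hx₂ hN).mono fun s₃ _ h₃ => ?_
      intro e' he' f' hf'
      rw [State.setReg_arr]
      by_cases hc : e' = e ∧ f' = f
      · obtain ⟨rfl, rfl⟩ := hc
        rw [h₃.2, h₂ e' he' f' hf']
        constructor
        · rintro (h' | h')
          · exact ⟨h'.1, .inr ⟨rfl, by omega⟩⟩
          · exact ⟨h', .inr ⟨rfl, by omega⟩⟩
        · exact fun h' => .inr h'.1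
      · rw [h₃.1 _ (by rwa [ne_eq, mul_add_inj hf' hf]), h₂ e' he' f' hf']
        refine and_congr_right fun _ => ?_
        omega
    · intro s₂ _ _ h₂ e' he' f' hf'
      rw [hP₁.m] at h₂
      rw [State.setReg_arr, h₂ e' he' f' hf']
      refine and_congr_right fun _ => ?_
      omega
  · intro s' _ _ hs' e he f hf
    rw [h.m] at hs'
    rw [hs' e he f hf]
    exact ⟨fun h => h.1, fun h => ⟨h, he⟩⟩

end RAM

/-! ### From a listed hypergraph to its conflict system -/

namespace BipartiteHypergraph

open RAM

variable {H : BipartiteHypergraph ℕ} {L : List (ℕ × List ℕ)}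

namespace IsListing

theorem edgeOf_mem (hL : H.IsListing L) {e : ℕ} (he : e < L.length) :
    edgeOf (edgeAt L e) ∈ H.E :=
  (hL.2.2 _).1 (List.mem_map_of_mem (edgeAt_mem he))

theorem exists_edgeAt (hL : H.IsListing L) {g : Finset ℕ} (hg : g ∈ H.E) :
    ∃ e < L.length, edgeOf (edgeAt L e) = g := by
  obtain ⟨x, hx, rfl⟩ := List.mem_map.1 ((hL.2.2 g).2 hg)
  obtain ⟨e, he, rfl⟩ := List.mem_iff_getElem.1 hx
  exact ⟨e, he, by rw [edgeAt_eq_getElem he]⟩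

theorem vert_mem (hL : H.IsListing L) {e : ℕ} (he : e < L.length) : (edgeAt L e).1 ∈ H.A :=
  (hL.1 _ (edgeAt_mem he)).1

theorem mem_B (hL : H.IsListing L) {e b : ℕ} (he : e < L.length) (hb : b ∈ (edgeAt L e).2) :
    b ∈ H.B :=
  (hL.1 _ (edgeAt_mem he)).2.2 b hb

theorem eq_vert (hL : H.IsListing L) {e a : ℕ} (he : e < L.length) (ha : a ∈ H.A)
    (hae : a ∈ edgeOf (edgeAt L e)) : a = (edgeAt L e).1 := by
  rcases mem_insert.1 hae with h | h
  · exact h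
  · exact absurd (hL.mem_B he (List.mem_toFinset.1 h)) (disjoint_left.1 H.disjoint_A_B ha)

theorem inter_B (hL : H.IsListing L) {e : ℕ} (he : e < L.length) :
    edgeOf (edgeAt L e) ∩ H.B = (edgeAt L e).2.toFinset := by
  ext b
  rw [mem_inter, edgeOf, mem_insert]
  constructor
  · rintro ⟨rfl | h, hb⟩
    · exact absurd hb (disjoint_left.1 H.disjoint_A_B (hL.vert_mem he))
    · exact h
  · exact fun h => ⟨.inr h, hL.mem_B he (List.mem_toFinset.1 h)⟩

theorem edgeLen_eq (hL : H.IsListing L) {e : ℕ} (he : e < L.length) :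
    edgeLen L e = (edgeOf (edgeAt L e) ∩ H.B).card := by
  rw [hL.inter_B he, List.toFinset_card_of_nodup (hL.1 _ (edgeAt_mem he)).2.1]
  rfl

theorem one_le_edgeLen (hL : H.IsListing L) {e : ℕ} (he : e < L.length) : 1 ≤ edgeLen L e := by
  rw [hL.edgeLen_eq he]
  exact H.one_le_card_inter_B _ (hL.edgeOf_mem he)

theorem edgeLen_le_maxLen {e : ℕ} (he : e < L.length) : edgeLen L e ≤ maxLen L :=
  le_sup (f := edgeLen L) (mem_range.2 he)

theorem maxLen_le (hL : H.IsListing L) {r : ℕ} (hr : H.IsBounded r) : maxLen L ≤ r := by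
  refine Finset.sup_le fun e he => ?_
  have he := mem_range.1 he
  rw [hL.edgeLen_eq he]
  exact hr _ (hL.edgeOf_mem he)

theorem edgeLen_le_volume (hL : H.IsListing L) {e : ℕ} (he : e < L.length) :
    edgeLen L e ≤ H.volume := by
  rw [hL.edgeLen_eq he]
  exact (card_le_card inter_subset_left).trans
    (single_le_sum (f := fun g : Finset ℕ => g.card) (fun _ _ => Nat.zero_le _)
      (hL.edgeOf_mem he))

theorem length_le_volume (hL : H.IsListing L) : L.length ≤ H.volume := by
  have h₁ : L.length = H.E.card := by
    have : (L.map edgeOf).toFinset = H.E := by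
      ext g
      rw [List.mem_toFinset, hL.2.2]
    rw [← this, List.toFinset_card_of_nodup hL.2.1, List.length_map]
  rw [h₁, card_eq_sum_ones]
  refine sum_le_sum fun g hg => ?_
  rw [← H.card_inter_A g hg]
  exact card_le_card inter_subset_left

/-- The `B`-vertices of the edges in `F` form a hitting set for the edges at `S`, of size at most
`F.card * maxLen L`. Compared with `φ * S.card` this leaves one factor `maxLen L` to cancel. The
bound `φ ≥ 4 * r ^ 2` passes to `maxLen L` because `maxLen L ≤ r`. -/
theorem hitting (hL : H.IsListing L) {r : ℕ} {φ : ℝ} (hr : H.IsBounded r)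
    (hφ : H.StrongHaxell φ) (hrφ : 4 * (r : ℝ) ^ 2 ≤ φ) (F S : Finset ℕ)
    (hF : F ⊆ range L.length) (hS : S ⊆ (range L.length).image fun e => (edgeAt L e).1)
    (h : ∀ e < L.length, (edgeAt L e).1 ∈ S → ∃ f ∈ F, EdgesMeet L e f) :
    4 * maxLen L * S.card ≤ F.card := by
  have hSA : S ⊆ H.A := by
    intro a ha
    obtain ⟨e, he, rfl⟩ := mem_image.1 (hS ha)
    exact hL.vert_mem (mem_range.1 he)
  set T := F.biUnion fun f => (edgeAt L f).2.toFinset with hT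
  have hTcard : T.card ≤ F.card * maxLen L := by
    refine card_biUnion_le_card_mul _ _ _ fun f hf => ?_
    exact (List.toFinset_card_le _).trans (edgeLen_le_maxLen (mem_range.1 (hF hf)))
  have htau : H.tau (H.edgesMeeting S) ≤ T.card := by
    refine Nat.sInf_le ⟨T, ?_, rfl, ?_⟩
    · intro b hb
      obtain ⟨f, hf, hb⟩ := mem_biUnion.1 hb
      exact hL.mem_B (mem_range.1 (hF hf)) (List.mem_toFinset.1 hb)
    · intro g hg
      obtain ⟨hg, a, ha⟩ := mem_filter.1 hg
      obtain ⟨e, he, rfl⟩ := hL.exists_edgeAt hg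
      obtain ⟨hae, haS⟩ := mem_inter.1 ha
      rw [hL.eq_vert he (hSA haS) hae] at haS
      obtain ⟨f, hf, b, hbe, hbf⟩ := h e he haS
      exact ⟨b, mem_inter.2 ⟨mem_insert_of_mem (List.mem_toFinset.2 hbe),
        mem_biUnion.2 ⟨f, hf, List.mem_toFinset.2 hbf⟩⟩⟩
  have hle : (maxLen L : ℝ) ≤ r := by exact_mod_cast hL.maxLen_le hr
  have h₁ : (4 * (maxLen L : ℝ) ^ 2) * S.card ≤ F.card * maxLen L := by
    calc (4 * (maxLen L : ℝ) ^ 2) * S.card ≤ (4 * (r : ℝ) ^ 2) * S.card := by gcongr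
      _ ≤ φ * S.card := by gcongr
      _ ≤ (H.tau (H.edgesMeeting S) : ℝ) := hφ S hSA
      _ ≤ T.card := by exact_mod_cast htau
      _ ≤ F.card * maxLen L := by exact_mod_cast hTcard
  have h₂ : 4 * maxLen L ^ 2 * S.card ≤ F.card * maxLen L := by exact_mod_cast h₁
  rcases Nat.eq_zero_or_pos (maxLen L) with h0 | h0
  · simp [h0]
  · refine Nat.le_of_mul_le_mul_right ?_ h0
    calc 4 * maxLen L * S.card * maxLen L = 4 * maxLen L ^ 2 * S.card := by ring
      _ ≤ _ := h₂

/-- Choose for every edge in `X` a `B`-vertex shared with `f`; since the edges are disjoint, the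
choice is injective. -/
theorem packing (X : Finset ℕ) {f : ℕ} (hf : f < L.length) (h₁ : ∀ e ∈ X, EdgesMeet L e f)
    (h₂ : ∀ e ∈ X, ∀ e' ∈ X, e ≠ e' → ¬ EdgesMeet L e e') : X.card ≤ maxLen L := by
  choose! b hb hb' using h₁
  have : X.card ≤ (edgeAt L f).2.toFinset.card := by
    refine card_le_card_of_injOn b (fun e he => List.mem_toFinset.2 (hb' e he)) ?_
    intro e he e' he' hbe
    by_contra hne
    exact h₂ e he e' he' hne ⟨b e, hb e he, hbe ▸ hb e' he'⟩
  exact this.trans ((List.toFinset_card_le _).trans (edgeLen_le_maxLen hf))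

/-- The conflict system of a listed hypergraph that satisfies the strong Haxell condition. -/
def conflictSystem (hL : H.IsListing L) {r : ℕ} {φ : ℝ} (hr : H.IsBounded r)
    (hφ : H.StrongHaxell φ) (hrφ : 4 * (r : ℝ) ^ 2 ≤ φ) : ConflictSystem where
  m := L.length
  r := maxLen L
  vert e := (edgeAt L e).1
  Conf := EdgesMeet L
  symm := fun _ _ ⟨b, h, h'⟩ => ⟨b, h', h⟩
  refl := fun e he => by
    obtain ⟨b, hb⟩ := List.exists_mem_of_length_pos (hL.one_le_edgeLen he)
    exact ⟨b, hb, hb⟩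
  one_le_r := fun h => (hL.one_le_edgeLen h).trans (edgeLen_le_maxLen h)
  hitting := hL.hitting hr hφ hrφ
  packing := fun X _ _ hf => packing X hf

/-- If no edge contained `a`, the empty set would be a hitting set for `{a}`, against `φ > 0`. Hence
covering the vertices of all edges covers `A`. -/
theorem exists_edge_at (hL : H.IsListing L) {φ : ℝ} (hφ : H.StrongHaxell φ) (hpos : 0 < φ)
    {a : ℕ} (ha : a ∈ H.A) : ∃ e < L.length, (edgeAt L e).1 = a := by
  by_contra hcon
  push Not at hcon
  have h₁ := hφ {a} (singleton_subset_iff.2 ha)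
  have h₂ : H.tau (H.edgesMeeting {a}) = 0 := by
    refine Nat.eq_zero_of_le_zero (Nat.sInf_le ⟨∅, empty_subset _, card_empty, ?_⟩)
    intro g hg
    obtain ⟨hg, b, hb⟩ := mem_filter.1 hg
    obtain ⟨e, he, rfl⟩ := hL.exists_edgeAt hg
    obtain ⟨hbe, hba⟩ := mem_inter.1 hb
    rw [mem_singleton.1 hba] at hbe
    exact absurd (hL.eq_vert he ha hbe).symm (hcon e he)
  rw [h₂, card_singleton] at h₁
  norm_num at h₁
  linarith

end IsListing

end BipartiteHypergraph

/-! ### The complete program and its correctness -/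

namespace RAM

variable {H : BipartiteHypergraph ℕ} {L : List (ℕ × List ℕ)}

/-- The program that computes a perfect matching. -/
def perfectMatching : Prog := .seq prepareOffsets (.seq prepareConflicts coverAll)

theorem isPerfectMatching_output (hL : H.IsListing L) {r : ℕ} {φ : ℝ} (hr : H.IsBounded r)
    (hφ : H.StrongHaxell φ) (hrφ : 4 * (r : ℝ) ^ 2 ≤ φ) (hpos : 0 < φ) {s : State}
    (hm : (hL.conflictSystem hr hφ hrφ).IsMatching s.cfg)
    (hc : ∀ e < L.length, (hL.conflictSystem hr hφ hrφ).Matched s.cfg (edgeAt L e).1) :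
    H.IsPerfectMatching (output L s) := by
  have hout : ∀ g, g ∈ output L s ↔
      ∃ e < L.length, s.arr 3 e ≠ 0 ∧ BipartiteHypergraph.edgeOf (edgeAt L e) = g := by
    intro g
    simp only [output, mem_image, mem_filter, mem_univ, true_and]
    constructor
    · rintro ⟨i, hi, rfl⟩
      exact ⟨i, i.2, hi, by rw [edgeAt_eq_getElem i.2]; rfl⟩
    · rintro ⟨e, he, hs, rfl⟩
      exact ⟨⟨e, he⟩, hs, by rw [edgeAt_eq_getElem he]; rfl⟩
  refine ⟨⟨fun g hg => ?_, fun g hg g' hg' hne => ?_⟩, fun a ha => ?_⟩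
  · obtain ⟨e, he, -, rfl⟩ := (hout g).1 hg
    exact hL.edgeOf_mem he
  · obtain ⟨e, he, hs, rfl⟩ := (hout g).1 hg
    obtain ⟨f, hf, hs', rfl⟩ := (hout g').1 hg'
    obtain ⟨h₁, h₂⟩ := hm e he f hf hs hs' (by rintro rfl; exact hne rfl)
    -- A common vertex lies in `A` or in `B`. On the `A`-side the two edges have different vertices,
    -- on the `B`-side they do not conflict, and a mixed coincidence is excluded because `A` and `B`
    -- are disjoint.
    rw [disjoint_left]
    intro b hb hb'
    rcases mem_insert.1 hb with rfl | h
    · exact h₁ (hL.eq_vert hf (hL.vert_mem he) hb')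
    · rcases mem_insert.1 hb' with rfl | h'
      · exact h₁ (hL.eq_vert he (hL.vert_mem hf) hb).symm
      · exact h₂ ⟨b, List.mem_toFinset.1 h, List.mem_toFinset.1 h'⟩
  · obtain ⟨e, he, rfl⟩ := hL.exists_edge_at hφ hpos ha
    obtain ⟨f, hf, hs, hv⟩ := hc e he
    refine ⟨_, (hout _).2 ⟨f, hf, hs, rfl⟩, mem_insert.2 (.inl ?_)⟩
    exact hv.symm

theorem runs_perfectMatching (hL : H.IsListing L) {r : ℕ} {φ : ℝ} (hr : H.IsBounded r)
    (hφ : H.StrongHaxell φ) (hrφ : 4 * (r : ℝ) ^ 2 ≤ φ) (hpos : 0 < φ) {N : ℕ}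
    (hN : (L.length + 2) * L.length ^ 45 + 1 ≤ N) (hmN : L.length ≤ N)
    (hlN : ∀ e < L.length, edgeLen L e ≤ N) :
    Runs N perfectMatching (input L) fun s => H.IsPerfectMatching (output L s) := by
  refine Runs.seq ((runs_prepareOffsets (L := L) rfl (input_arr_one L) hmN).mono
    fun s₁ hf₁ h₁ => Runs.seq ?_)
  have hP₁ : Prepared L s₁ := by
    refine ⟨hf₁.1 0 rfl, (hf₁.2 1 rfl).trans (input_arr_one L), fun e he u hu => ?_,
      fun e he => (h₁.2 e he).2⟩
    rw [hf₁.2 2 rfl, (h₁.2 e he).1]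
    exact flatMap_getD L he hu
  -- Memory outside the input is zero: the conflict matrix starts unmarked and, below, the search
  -- starts from the empty matching.
  have h4 : s₁.arr 4 = fun _ => 0 := hf₁.2 4 rfl
  refine (runs_prepareConflicts hP₁ (fun i => by rw [h4]) hmN hlN).mono fun s₂ hf₂ h₂ => ?_
  have hP₂ := hP₁.frame hf₂ ⟨rfl, rfl, rfl, rfl, rfl⟩
  have hE : Env (hL.conflictSystem hr hφ hrφ) s₂ := by
    refine ⟨hP₂.m, (hf₂.1 1 rfl).trans h₁.1,
      (hf₂.2 0 rfl).trans ((hf₁.2 0 rfl).trans (input_arr_zero L)), fun e he f hf => ?_⟩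
    rw [hP₂.base e he]
    exact h₂ e he f hf
  have hsel : s₂.cfg.sel = fun _ => 0 := (hf₂.2 3 rfl).trans (hf₁.2 3 rfl)
  refine (runs_coverAll hE hN hmN fun e _ f _ hs => ?_).mono fun s₃ _ h₃ => ?_
  · rw [hsel] at hs
    exact absurd rfl hs
  · exact isPerfectMatching_output hL hr hφ hrφ hpos h₃.1 h₃.2

end RAM

end

theorem theorem5 :
    ∃ (P : RAM.Prog) (q : Polynomial ℕ),
      ∀ (H : BipartiteHypergraph ℕ) (r : ℕ) (φ : ℝ),
        1 ≤ r → H.IsBounded r → H.StrongHaxell φ → 4 * (r : ℝ) ^ 2 ≤ φ →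
          ∀ L : List (ℕ × List ℕ), H.IsListing L →
            ∃ (t : ℕ) (s : RAM.State),
              RAM.Exec P (RAM.input L) t s ∧
              t ≤ q.eval H.volume ∧
              H.IsPerfectMatching (RAM.output L s) := by
  -- With the volume for `X`, the inner polynomial is the common bound `N` for all loops: the first
  -- summands cover the rounds of a search, and the last `X` covers the number of edges and their
  -- lengths.
  refine ⟨RAM.perfectMatching, RAM.perfectMatching.timePoly.comp
    ((Polynomial.X + 2) * Polynomial.X ^ 45 + 1 + Polynomial.X), ?_⟩
  intro H r φ h1 hr hφ hrφ L hL
  have hpos : 0 < φ := by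
    have : (1 : ℝ) ≤ r := by exact_mod_cast h1
    nlinarith
  have hm := hL.length_le_volume
  have hpow : (L.length + 2) * L.length ^ 45 ≤ (H.volume + 2) * H.volume ^ 45 := by gcongr
  obtain ⟨t, s, h₁, h₂, h₃⟩ := RAM.runs_perfectMatching hL hr hφ hrφ hpos
    (N := (H.volume + 2) * H.volume ^ 45 + 1 + H.volume) (by omega) (by omega)
    fun e he => (hL.edgeLen_le_volume he).trans (Nat.le_add_left _ _)
  refine ⟨t, s, h₁, ?_, h₃⟩
  rw [Polynomial.eval_comp, RAM.Prog.eval_timePoly]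
  simpa using h₂
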